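/- Let $H\in M(p,\mathbb{R})$ be a matrix all of whose (complex) eigenvalues have real part in $(0,1)$, put $D=H-\tfrac12 I$, and write $c^{M}=\exp(M\log c)$ for $c>0$. For $A\in M(p,\mathbb{C})$ and $t\in\mathbb{R}$ let $$\widetilde g_t(x)=\frac{e^{\mathbf{i}tx}-1}{\mathbf{i}x}\bigl\{x_+^{-D}A+x_-^{-D}\overline{A}\bigr\},\quad x\neq0,\qquad g_t=\mathcal F^{-1}(\widetilde g_t)\in L^2(\mathbb{R},M(p,\mathbb{R})),$$ where $\mathcal F f(x)=\int_{\mathbb{R}}e^{\mathbf{i}sx}f(s)\,ds$ is extended entrywise to $L^2$. Let $\mu$ be a measure on $\mathbb{R}^p$ (respectively $\mathbb{C}^p$) with $\int\|\mathbf z\|^2\mu(d\mathbf z)<\infty$ and $\mu(\{\mathbf 0\})=0$ (the Lévy measure), let $N$ be a Poisson random measure on $\mathbb{R}\times\mathbb{R}^p$ (respectively $\mathbb{R}\times\mathbb{C}^p$) with intensity $ds\,\mu(d\mathbf z)$, and let $\widetilde N=N-ds\,\mu(d\mathbf z)$; integrals with respect to $\widetilde N$ are $L^2(\mathbb{P})$-limits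 of integrals of elementary functions. An $\mathbb{R}^p$-valued process is called proper if, for every $t\neq0$, its law at time $t$ is not concentrated on a proper linear subspace of $\mathbb{R}^p$. A moving average operator fractional Lévy motion (maofLm) with Hurst exponent $H$ and Lévy measure $\mu$ on $\mathbb{R}^p$ is a proper process $X_H$ with the finite-dimensional distributions of $\bigl\{\int_{\mathbb{R}\times\mathbb{R}^p}g_t(s)\mathbf z\,\widetilde N(ds,d\mathbf z)\bigr\}_{t\in\mathbb{R}}$ for some $A$. A real harmonizable operator fractional Lévy motion (rhofLm) with Hurst exponent $H$ and Lévy measure $\mu$ on $\mathbb{C}^p$ is a proper process $\widetilde X_H$ with the finite-dimensional distributions of $\bigl\{\int_{\mathbb{R}\times\mathbb{C}^p}2\Re(\widetilde g_t(x)\mathbf z)\,\widetilde N(dx,d\mathbf z)\bigr\}_{t\in\mathbb{R}}$ for some $A$. An operator fractional Brownian motion (ofBm) with Hurst exponent $H$ is a proper Gaussian process $B_H=\{B_H(t)\}_{t\in\mathbb{R}}$ with stationary increments such that $\{B_H(ct)\}_{t\in\mathbb{R}}$ and $\{c^HB_H(t)\}_{t\in\mathbb{R}}$ have the same finite-dimensional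 distributions for every $c>0$. (i) Let $X_H$ be a maofLm with Hurst exponent $H$ whose Lévy measure satisfies $\int_{\mathbb{R}^p}\mathbf z\mathbf z^*\mu(d\mathbf z)=I$. Then there is an ofBm $B_H$ with Hurst exponent $H$ such that, as $c\to\infty$, $$\{c^{-H}X_H(ct)\}_{t\in\mathbb{R}}\to\{B_H(t)\}_{t\in\mathbb{R}}$$ in the sense of convergence of finite-dimensional distributions. (ii) Let $\widetilde X_H$ be a rhofLm with Hurst exponent $H$ whose Lévy measure satisfies $4\int_{\mathbb{C}^p}(\Re\mathbf z)(\Re\mathbf z)^*\mu(d\mathbf z)=I=4\int_{\mathbb{C}^p}(\Im\mathbf z)(\Im\mathbf z)^*\mu(d\mathbf z)$. Then there is an ofBm $B_H$ with Hurst exponent $H$ such that, for every fixed $s\in\mathbb{R}$, as $\varepsilon\to0^+$, $$\{\varepsilon^{-H}(\widetilde X_H(s+\varepsilon t)-\widetilde X_H(s))\}_{t\in\mathbb{R}}\to\{B_H(t)\}_{t\in\mathbb{R}}$$ in the sense of convergence of finite-dimensional distributions. -/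

import Mathlib

open MeasureTheory ProbabilityTheory Filter Topology
open scoped ENNReal NNReal FourierTransform

universe u v

noncomputable section

namespace OfLm

/-! ### Matrix powers and conditions on the Hurst matrix -/

/-- The matrix power `c ^ M = exp (log c • M)`, for `c > 0`. -/
def matPow {p : ℕ} (c : ℝ) (M : Matrix (Fin p) (Fin p) ℝ) : Matrix (Fin p) (Fin p) ℝ :=
  NormedSpace.exp (Real.log c • M)

/-- A real matrix regarded as a complex matrix. -/
def toComplex {p : ℕ} (M : Matrix (Fin p) (Fin p) ℝ) : Matrix (Fin p) (Fin p) ℂ :=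
  M.map (fun r : ℝ => (r : ℂ))

/-- The real parts of all the (complex) eigenvalues of `H` lie in the set `S`. -/
def ReEigIn {p : ℕ} (H : Matrix (Fin p) (Fin p) ℝ) (S : Set ℝ) : Prop :=
  ∀ z ∈ spectrum ℂ (toComplex H), z.re ∈ S

/-! ### Finite-dimensional distributions -/

section Processes

variable {Ω Ω' : Type*} [MeasurableSpace Ω] [MeasurableSpace Ω'] {p : ℕ}

/-- Equality of the finite-dimensional distributions of `X` (under `P`) and `Y` (under `P'`). -/
def FddEq (P : Measure Ω) (X : ℝ → Ω → EuclideanSpace ℝ (Fin p))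
    (P' : Measure Ω') (Y : ℝ → Ω' → EuclideanSpace ℝ (Fin p)) : Prop :=
  ∀ I : Finset ℝ, IdentDistrib (fun ω => I.restrict (fun t => X t ω))
    (fun ω => I.restrict (fun t => Y t ω)) P P'

/-- Convergence of finite-dimensional distributions, along the filter `l`, of the processes
`X c` (under `P`) to the process `B` (under `P'`). -/
def FddTendsto (P : Measure Ω) [IsProbabilityMeasure P]
    (X : ℝ → ℝ → Ω → EuclideanSpace ℝ (Fin p)) (l : Filter ℝ)
    (P' : Measure Ω') [IsProbabilityMeasure P'] (B : ℝ → Ω' → EuclideanSpace ℝ (Fin p)) : Prop :=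
  ∀ I : Finset ℝ, TendstoInDistribution (fun c ω => I.restrict (fun t => X c t ω)) l
    (fun ω => I.restrict (fun t => B t ω)) (fun _ => P) P'

/-- For each `t ≠ 0`, the law of `X t` is not concentrated on any proper subspace. -/
def IsProper (P : Measure Ω) (X : ℝ → Ω → EuclideanSpace ℝ (Fin p)) : Prop :=
  ∀ t : ℝ, t ≠ 0 → ∀ V : Submodule ℝ (EuclideanSpace ℝ (Fin p)), V ≠ ⊤ →
    ¬ ∀ᵐ ω ∂P, X t ω ∈ V

/-- Operator fractional Brownian motion with Hurst exponent `H`: a proper Gaussian process which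
is operator self-similar with exponent `H` and has (strictly) stationary increments. -/
structure IsOfBm (P : Measure Ω) (B : ℝ → Ω → EuclideanSpace ℝ (Fin p))
    (H : Matrix (Fin p) (Fin p) ℝ) : Prop where
  hurst : ReEigIn H (Set.Ioc 0 1)
  gaussian : IsGaussianProcess B P
  proper : IsProper P B
  selfSimilar : ∀ c : ℝ, 0 < c →
    FddEq P (fun t => B (c * t)) P (fun t ω => Matrix.toEuclideanLin (matPow c H) (B t ω))
  stationaryIncrements : ∀ h : ℝ,
    FddEq P (fun t ω => B (t + h) ω - B h ω) P (fun t ω => B t ω - B 0 ω)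

end Processes

/-! ### Poisson random measures and integrals with respect to their compensation -/

/-- `N` is a Poisson random measure on `S` with intensity measure `ν`. -/
structure IsPoissonRandomMeasure {Ω S : Type*} [MeasurableSpace Ω] [MeasurableSpace S]
    (P : Measure Ω) (N : Ω → Measure S) (ν : Measure S) : Prop where
  measurable : ∀ B : Set S, MeasurableSet B → Measurable (fun ω => N ω B)
  law : ∀ B : Set S, MeasurableSet B → ν B ≠ ∞ →
    P.map (fun ω => N ω B) =
      (poissonMeasure (ν B).toNNReal).map (fun k : ℕ => (k : ℝ≥0∞))
  law_top : ∀ B : Set S, MeasurableSet B → ν B = ∞ → ∀ᵐ ω ∂P, N ω B = ∞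
  indep : ∀ (n : ℕ) (B : Fin n → Set S), (∀ i, MeasurableSet (B i)) →
    Pairwise (fun i j => Disjoint (B i) (B j)) → iIndepFun (fun i ω => N ω (B i)) P

/-- The compensated random measure `N(B) - ν(B)`, on sets `B` with `ν B < ∞`. -/
def compensated {Ω S : Type*} [MeasurableSpace S] (N : Ω → Measure S) (ν : Measure S)
    (B : Set S) (ω : Ω) : ℝ :=
  (N ω B).toReal - (ν B).toReal

/-- Elementary functions `∑ i, φ_i 1_{B_{1,i} × B_{2,i}}` on `ℝ × Z`, where the measurable
rectangles have finite `ν`-measure. -/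
structure Elementary {Z : Type*} [MeasurableSpace Z] (ν : Measure (ℝ × Z)) (p : ℕ) where
  size : ℕ
  coef : Fin size → EuclideanSpace ℝ (Fin p)
  left : Fin size → Set ℝ
  right : Fin size → Set Z
  measurableSet_left : ∀ i, MeasurableSet (left i)
  measurableSet_right : ∀ i, MeasurableSet (right i)
  finite : ∀ i, ν (left i ×ˢ right i) ≠ ∞

/-- The function that an elementary function stands for. -/
def Elementary.toFun {Z : Type*} [MeasurableSpace Z] {ν : Measure (ℝ × Z)} {p : ℕ}
    (e : Elementary ν p) (x : ℝ × Z) : EuclideanSpace ℝ (Fin p) :=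
  ∑ i, (e.left i ×ˢ e.right i).indicator (fun _ => e.coef i) x

/-- The integral of an elementary function against the compensated random measure. -/
def Elementary.integral {Ω Z : Type*} [MeasurableSpace Z] {ν : Measure (ℝ × Z)} {p : ℕ}
    (e : Elementary ν p) (N : Ω → Measure (ℝ × Z)) (ω : Ω) : EuclideanSpace ℝ (Fin p) :=
  ∑ i, compensated N ν (e.left i ×ˢ e.right i) ω • e.coef i

/-- The random vector `Y` is (a version of) the stochastic integral of the function
`φ ∈ 𝓛²(ν)` with respect to the compensated Poisson random measure `N - ν`: it is the
`L²(P)`-limit of the integrals of elementary functions that converge to `φ` in `𝓛²(ν)`. -/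
def IsStochIntegral {Ω Z : Type*} [MeasurableSpace Ω] [MeasurableSpace Z] {p : ℕ}
    (P : Measure Ω) (N : Ω → Measure (ℝ × Z)) (ν : Measure (ℝ × Z))
    (φ : ℝ × Z → EuclideanSpace ℝ (Fin p)) (Y : Ω → EuclideanSpace ℝ (Fin p)) : Prop :=
  MemLp φ 2 ν ∧ MemLp Y 2 P ∧
    ∃ e : ℕ → Elementary ν p,
      Tendsto (fun n => eLpNorm (fun x => (e n).toFun x - φ x) 2 ν) atTop (𝓝 0) ∧
      Tendsto (fun n => eLpNorm (fun ω => (e n).integral N ω - Y ω) 2 P) atTop (𝓝 0)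

/-- A Lévy measure with finite second moment: `∫ ‖z‖² dμ < ∞` and `μ {0} = 0`. -/
structure IsLevyMeasure₂ {E : Type*} [NormedAddCommGroup E] [MeasurableSpace E]
    (μ : Measure E) : Prop where
  secondMoment : ∫⁻ z, ‖z‖ₑ ^ 2 ∂μ < ∞
  zero : μ {0} = 0

/-! ### The kernels -/

/-- The Fourier domain kernel
`g̃_t(x) = (e^{itx} - 1) / (ix) * (x₊^{-D} A + x₋^{-D} conj A)` with `D = H - (1/2) I`. -/
def harmKernel {p : ℕ} (H : Matrix (Fin p) (Fin p) ℝ) (A : Matrix (Fin p) (Fin p) ℂ)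
    (t x : ℝ) : Matrix (Fin p) (Fin p) ℂ :=
  let D : Matrix (Fin p) (Fin p) ℝ := H - (1 / 2 : ℝ) • (1 : Matrix (Fin p) (Fin p) ℝ)
  ((Complex.exp (Complex.I * t * x) - 1) / (Complex.I * x)) •
    (if 0 < x then toComplex (matPow x (-D)) * A
      else if x < 0 then toComplex (matPow (-x) (-D)) * A.map (starRingEnd ℂ)
      else 0)

/-- `F ∈ L²(ℝ)` is the Fourier transform of `f ∈ L²(ℝ)` in the normalization
`F(x) = ∫ e^{isx} f(s) ds` (extended to `L²`). In Mathlib's normalization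
`(𝓕 f)(ξ) = ∫ e^{-2πisξ} f(s) ds` this means that `(𝓕 f)(ξ) = F(-2πξ)`. -/
def IsL2Fourier (f F : ℝ → ℂ) : Prop :=
  ∃ (hf : MemLp f 2 volume) (hF : MemLp (fun ξ : ℝ => F (-(2 * Real.pi * ξ))) 2 volume),
    𝓕 (hf.toLp f) = hF.toLp (fun ξ : ℝ => F (-(2 * Real.pi * ξ)))

/-- The time domain kernel: `g_t ∈ L²(ℝ, M(p, ℝ))` is the entrywise inverse Fourier transform of
the Fourier domain kernel `g̃_t`, for every `t`. -/
def IsTimeKernel {p : ℕ} (H : Matrix (Fin p) (Fin p) ℝ) (A : Matrix (Fin p) (Fin p) ℂ)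
    (g : ℝ → ℝ → Matrix (Fin p) (Fin p) ℝ) : Prop :=
  ∀ (t : ℝ) (i j : Fin p),
    IsL2Fourier (fun s => ((g t s i j : ℝ) : ℂ)) (fun x => harmKernel H A t x i j)

/-! ### Operator fractional Lévy motions -/

/-- `X` is a moving average operator fractional Lévy motion (without Gaussian component) with
Hurst matrix `H`, parameter `A` and Lévy measure `μ`: it is proper and has the finite-dimensional
distributions of `t ↦ ∫ g_t(s) z (N(ds, dz) - ds μ(dz))`, where `N` is a Poisson random measure on
`ℝ × ℝ^p` with intensity `ds ⊗ μ`. -/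
structure IsMaofLm {Ω : Type u} [MeasurableSpace Ω] {p : ℕ} (P : Measure Ω)
    (X : ℝ → Ω → EuclideanSpace ℝ (Fin p)) (H : Matrix (Fin p) (Fin p) ℝ)
    (A : Matrix (Fin p) (Fin p) ℂ) (μ : Measure (EuclideanSpace ℝ (Fin p))) : Prop where
  hurst : ReEigIn H (Set.Ioo 0 1)
  levy : IsLevyMeasure₂ μ
  proper : IsProper P X
  representation : ∃ (Ω' : Type v) (_ : MeasurableSpace Ω') (P' : Measure Ω')
    (N : Ω' → Measure (ℝ × EuclideanSpace ℝ (Fin p)))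
    (g : ℝ → ℝ → Matrix (Fin p) (Fin p) ℝ) (Y : ℝ → Ω' → EuclideanSpace ℝ (Fin p)),
    IsProbabilityMeasure P' ∧
    IsPoissonRandomMeasure P' N ((volume : Measure ℝ).prod μ) ∧
    IsTimeKernel H A g ∧
    (∀ t, IsStochIntegral P' N ((volume : Measure ℝ).prod μ)
      (fun x => Matrix.toEuclideanLin (g t x.1) x.2) (Y t)) ∧
    FddEq P X P' Y

/-- `X` is a real harmonizable operator fractional Lévy motion (without Gaussian component) with
Hurst matrix `H`, parameter `A` and Lévy measure `μ`: it is proper and has the finite-dimensional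
distributions of `t ↦ ∫ 2 Re (g̃_t(x) z) (N(dx, dz) - dx μ(dz))`, where `N` is a Poisson random
measure on `ℝ × ℂ^p` with intensity `dx ⊗ μ`. -/
structure IsRhofLm {Ω : Type u} [MeasurableSpace Ω] {p : ℕ} (P : Measure Ω)
    (X : ℝ → Ω → EuclideanSpace ℝ (Fin p)) (H : Matrix (Fin p) (Fin p) ℝ)
    (A : Matrix (Fin p) (Fin p) ℂ) (μ : Measure (EuclideanSpace ℂ (Fin p))) : Prop where
  hurst : ReEigIn H (Set.Ioo 0 1)
  levy : IsLevyMeasure₂ μ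
  proper : IsProper P X
  representation : ∃ (Ω' : Type v) (_ : MeasurableSpace Ω') (P' : Measure Ω')
    (N : Ω' → Measure (ℝ × EuclideanSpace ℂ (Fin p)))
    (Y : ℝ → Ω' → EuclideanSpace ℝ (Fin p)),
    IsProbabilityMeasure P' ∧
    IsPoissonRandomMeasure P' N ((volume : Measure ℝ).prod μ) ∧
    (∀ t, IsStochIntegral P' N ((volume : Measure ℝ).prod μ)
      (fun x => WithLp.toLp 2
        (fun i => 2 * (Matrix.toEuclideanLin (harmKernel H A t x.1) x.2 i).re)) (Y t)) ∧
    FddEq P X P' Y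

/-- `∫ z z^* μ(dz) = I`. -/
def HasIdentitySecondMoment {p : ℕ} (μ : Measure (EuclideanSpace ℝ (Fin p))) : Prop :=
  ∀ i j, ∫ z, z i * z j ∂μ = (1 : Matrix (Fin p) (Fin p) ℝ) i j

/-- `4 ∫ (Re z) (Re z)^* μ(dz) = I = 4 ∫ (Im z) (Im z)^* μ(dz)`. -/
def HasComplexIdentitySecondMoment {p : ℕ} (μ : Measure (EuclideanSpace ℂ (Fin p))) : Prop :=
  (∀ i j, 4 * ∫ z, (z i).re * (z j).re ∂μ = (1 : Matrix (Fin p) (Fin p) ℝ) i j) ∧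
  (∀ i j, 4 * ∫ z, (z i).im * (z j).im ∂μ = (1 : Matrix (Fin p) (Fin p) ℝ) i j)

end OfLm

end

/-! For a compensated Poisson integral of kernels `φ_t` with intensity `ν`, the joint characteristic
function is `exp ∫ ψ(∑ j, ⟨θ_j, φ_{t_j}⟩) dν`, where `ψ(u) = e^{iu} - 1 - iu` is `compExp`
(`fddCharFun_stochIntegral`). Near the origin `ψ(u)` is `-u²/2`. Hence `δ⁻² ∫ ψ(δ G) dν → -½ ∫ G²
dν` as `δ → 0` (`tendsto_integral_compExp_scaled`), and the right side is a Gaussian exponent.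

The rescaling of the processes has exactly this form. The spectral kernel satisfies `g̃_{ct}(x) = √c
c^H g̃_t(cx)` (`harmKernel_mul`), so in the time domain `g_{ct}(s) = c^{-1/2} c^H g_t(s/c)`. For the
moving average, the normalization removes `c^H` and the substitution `s ↦ cs` gives `c ∫ ψ(c^{-1/2}
G) dν`, which is Gaussian in the limit `c → ∞`. For the harmonizable process the integration is over
frequencies, where dilation acts the opposite way: one gets `ε⁻¹ ∫ ψ(√ε G_ε) dν`, which is Gaussian
in the limit `ε → 0`. There an increment starting at `s` also puts an oscillating phase into `G_ε`.
It has modulus one, so `∫ G_ε² dν` does not depend on `ε` and only a common `L²` majorant is needed.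

The limit is built as a Gaussian process with covariance that of the kernels in `L²(ν)`, using an
isonormal process (`exists_gaussianProcess_of_memLp`). The moment normalization of `μ`, together
with Parseval for the moving average and Hermitian symmetry for the harmonizable process, identifies
its variances with `specEnergy` up to a constant. Self-similarity is then a change of variables in
frequency. Stationarity of increments holds because a time shift multiplies the spectral row by a
phase. Properness is inherited from the Lévy process: if `⟨θ, φ_t⟩` vanishes `ν`-a.e., the Poisson
integral is a.s. orthogonal to `θ` too. -/

noncomputable section

namespace OfLm

/-! ### Characteristic functions of finite-dimensional distributions -/

section CharFun

variable {Ω Ω' J : Type*} [MeasurableSpace Ω] [MeasurableSpace Ω'] [Fintype J] {p : ℕ}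

/-- The characteristic function of the finite-dimensional distributions of `X`. -/
def fddCharFun (P : Measure Ω) (X : ℝ → Ω → EuclideanSpace ℝ (Fin p)) (t : J → ℝ)
    (θ : J → EuclideanSpace ℝ (Fin p)) : ℂ :=
  ∫ ω, Complex.exp ((∑ j, inner ℝ (θ j) (X (t j) ω) : ℝ) * Complex.I) ∂P

/-- `charFun` needs an inner product, so the finite product is passed to its `PiLp 2` version before
taking characteristic functions. -/
theorem charFun_map_toLp_restrict {P : Measure Ω} {X : ℝ → Ω → EuclideanSpace ℝ (Fin p)}
    (hX : ∀ t, AEMeasurable (X t) P) (I : Finset ℝ)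
    (θ : PiLp 2 (fun _ : I => EuclideanSpace ℝ (Fin p))) :
    charFun (P.map (fun ω => WithLp.toLp 2 (I.restrict (fun t => X t ω)))) θ =
      fddCharFun P X (fun i : I => (i : ℝ)) (fun i => θ i) := by
  have hm : AEMeasurable (fun ω => WithLp.toLp 2 (I.restrict (fun t => X t ω))) P :=
    (WithLp.measurable_toLp 2 _).comp_aemeasurable (aemeasurable_pi_lambda _ fun i => hX i)
  rw [charFun_apply, integral_map hm (by fun_prop), fddCharFun]
  simp [PiLp.inner_apply, mul_comm]

theorem aemeasurable_restrict {P : Measure Ω} {X : ℝ → Ω → EuclideanSpace ℝ (Fin p)}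
    (hX : ∀ t, AEMeasurable (X t) P) (I : Finset ℝ) :
    AEMeasurable (fun ω => I.restrict (fun t => X t ω)) P :=
  aemeasurable_pi_lambda _ fun i => hX i

theorem fddEq_of_fddCharFun_eq {P : Measure Ω} {P' : Measure Ω'} [IsProbabilityMeasure P]
    [IsProbabilityMeasure P'] {X : ℝ → Ω → EuclideanSpace ℝ (Fin p)}
    {Y : ℝ → Ω' → EuclideanSpace ℝ (Fin p)}
    (hX : ∀ t, AEMeasurable (X t) P) (hY : ∀ t, AEMeasurable (Y t) P')
    (h : ∀ (I : Finset ℝ) (θ : I → EuclideanSpace ℝ (Fin p)),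
      fddCharFun P X (fun i : I => (i : ℝ)) θ = fddCharFun P' Y (fun i : I => (i : ℝ)) θ) :
    FddEq P X P' Y := by
  intro I
  refine ⟨aemeasurable_restrict hX I, aemeasurable_restrict hY I, ?_⟩
  apply (MeasurableEquiv.toLp 2 (I → EuclideanSpace ℝ (Fin p))).map_measurableEquiv_injective
  rw [AEMeasurable.map_map_of_aemeasurable (by fun_prop) (aemeasurable_restrict hX I),
    AEMeasurable.map_map_of_aemeasurable (by fun_prop) (aemeasurable_restrict hY I)]
  have := Measure.isProbabilityMeasure_map (μ := P)
    (f := fun ω => WithLp.toLp 2 (I.restrict (fun t => X t ω)))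
    ((WithLp.measurable_toLp 2 _).comp_aemeasurable (aemeasurable_restrict hX I))
  have := Measure.isProbabilityMeasure_map (μ := P')
    (f := fun ω => WithLp.toLp 2 (I.restrict (fun t => Y t ω)))
    ((WithLp.measurable_toLp 2 _).comp_aemeasurable (aemeasurable_restrict hY I))
  refine Measure.ext_of_charFun (μ := P.map (fun ω => WithLp.toLp 2 (I.restrict (fun t => X t ω))))
    (ν := P'.map (fun ω => WithLp.toLp 2 (I.restrict (fun t => Y t ω)))) ?_
  funext θ
  rw [charFun_map_toLp_restrict hX, charFun_map_toLp_restrict hY]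
  exact h I _

theorem FddEq.aemeasurable_left {P : Measure Ω} {P' : Measure Ω'}
    {X : ℝ → Ω → EuclideanSpace ℝ (Fin p)} {Y : ℝ → Ω' → EuclideanSpace ℝ (Fin p)}
    (h : FddEq P X P' Y) (t : ℝ) : AEMeasurable (X t) P :=
  (measurable_pi_apply (⟨t, by simp⟩ : ({t} : Finset ℝ))).comp_aemeasurable
    (h {t}).aemeasurable_fst

/-- The family `t` may repeat times, as happens when a base point is adjoined for increments; it
factors through the finite set of its values. -/
theorem FddEq.fddCharFun_eq {P : Measure Ω} {P' : Measure Ω'}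
    {X : ℝ → Ω → EuclideanSpace ℝ (Fin p)} {Y : ℝ → Ω' → EuclideanSpace ℝ (Fin p)}
    (h : FddEq P X P' Y) (t : J → ℝ) (θ : J → EuclideanSpace ℝ (Fin p)) :
    fddCharFun P X t θ = fddCharFun P' Y t θ := by
  classical
  let I : Finset ℝ := Finset.univ.image t
  have ht : ∀ j, t j ∈ I := fun j => Finset.mem_image_of_mem _ (Finset.mem_univ j)
  let f : (I → EuclideanSpace ℝ (Fin p)) → ℂ := fun x =>
    Complex.exp ((∑ j, inner ℝ (θ j) (x ⟨t j, ht j⟩) : ℝ) * Complex.I)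
  have hf : Measurable f := by fun_prop
  exact ((h I).comp hf).integral_eq

/-- By Riesz on each factor, a continuous functional on the finite product is a sum of inner
products, so one-dimensional laws decide Gaussianity. -/
theorem isGaussianProcess_of_fddCharFun {P : Measure Ω} [IsProbabilityMeasure P]
    {X : ℝ → Ω → EuclideanSpace ℝ (Fin p)} (hX : ∀ t, AEMeasurable (X t) P)
    (h : ∀ (I : Finset ℝ) (θ : I → EuclideanSpace ℝ (Fin p)), ∃ v : ℝ≥0,
      P.map (fun ω => ∑ i : I, inner ℝ (θ i) (X i ω)) = gaussianReal 0 v) :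
    IsGaussianProcess X P := by
  refine ⟨fun I => ⟨isGaussian_of_map_eq_gaussianReal fun L => ?_⟩⟩
  classical
  let L' : I → EuclideanSpace ℝ (Fin p) := fun i => (InnerProductSpace.toDual ℝ _).symm
    (L.comp (ContinuousLinearMap.single ℝ (fun _ : I => EuclideanSpace ℝ (Fin p)) i))
  obtain ⟨v, hv⟩ := h I L'
  refine ⟨0, v, ?_⟩
  rw [AEMeasurable.map_map_of_aemeasurable (by fun_prop) (aemeasurable_restrict hX I), ← hv]
  congr 1
  ext ω
  simp only [L', InnerProductSpace.toDual_symm_apply, Function.comp_apply]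
  rw [← Finset.univ_sum_single (I.restrict (fun t => X t ω)), map_sum]
  rfl

/-- Lévy's continuity theorem for finite-dimensional distributions. -/
theorem fddTendsto_of_tendsto_fddCharFun {P : Measure Ω} {P' : Measure Ω'}
    [IsProbabilityMeasure P] [IsProbabilityMeasure P']
    {X : ℝ → ℝ → Ω → EuclideanSpace ℝ (Fin p)} {l : Filter ℝ} [l.IsCountablyGenerated]
    {B : ℝ → Ω' → EuclideanSpace ℝ (Fin p)}
    (hX : ∀ c t, AEMeasurable (X c t) P) (hB : ∀ t, AEMeasurable (B t) P')
    (h : ∀ (I : Finset ℝ) (θ : I → EuclideanSpace ℝ (Fin p)),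
      Tendsto (fun c => fddCharFun P (X c) (fun i : I => (i : ℝ)) θ) l
        (𝓝 (fddCharFun P' B (fun i : I => (i : ℝ)) θ))) :
    FddTendsto P X l P' B := by
  intro I
  have key : TendstoInDistribution
      (fun c ω => WithLp.toLp 2 (I.restrict (fun t => X c t ω))) l
      (fun ω => WithLp.toLp 2 (I.restrict (fun t => B t ω))) (fun _ => P) P' := by
    have hm : ∀ c, AEMeasurable (fun ω => WithLp.toLp 2 (I.restrict (fun t => X c t ω))) P :=
      fun c => (WithLp.measurable_toLp 2 _).comp_aemeasurable (aemeasurable_restrict (hX c) I)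
    have hm' : AEMeasurable (fun ω => WithLp.toLp 2 (I.restrict (fun t => B t ω))) P' :=
      (WithLp.measurable_toLp 2 _).comp_aemeasurable (aemeasurable_restrict hB I)
    refine ⟨hm, hm', ?_⟩
    -- The continuity theorem is applied along sequences, which suffices because `l` is countably
    -- generated.
    refine tendsto_of_seq_tendsto fun c hc => ?_
    refine ProbabilityMeasure.tendsto_of_tendsto_charFun fun θ => ?_
    have := (h I (fun i => θ i)).comp hc
    rw [← charFun_map_toLp_restrict hB] at this
    refine this.congr fun n => ?_
    exact (charFun_map_toLp_restrict (hX (c n)) I θ).symm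
  exact key.continuous_comp (g := WithLp.ofLp) (by fun_prop)

end CharFun

/-! ### Estimates for the compensated exponential -/

/-- The compensated exponential `e^{iu} - 1 - iu`. -/
def compExp (u : ℝ) : ℂ := Complex.exp (u * Complex.I) - 1 - u * Complex.I

@[simp] theorem compExp_zero : compExp 0 = 0 := by simp [compExp]

@[fun_prop]
theorem continuous_compExp : Continuous compExp := by unfold compExp; fun_prop

theorem norm_exp_mul_I_sub_one_le (u : ℝ) : ‖Complex.exp (u * Complex.I) - 1‖ ≤ |u| := by
  have := Real.norm_exp_I_mul_ofReal_sub_one_le (x := u)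
  rwa [mul_comm] at this

/-- Mean value inequality on `[-|u|, |u|]`, where the derivative `i(e^{ix} - 1)` has norm at most
`|u|`. The sharp constant `1/2` is not needed. -/
theorem norm_compExp_le (u : ℝ) : ‖compExp u‖ ≤ u ^ 2 := by
  have hd : ∀ x : ℝ, HasDerivAt compExp ((Complex.exp (x * Complex.I) - 1) * Complex.I) x := by
    intro x
    have h1 : HasDerivAt (fun y : ℝ => (y : ℂ) * Complex.I) Complex.I x := by
      simpa using (Complex.ofRealCLM.hasDerivAt (x := x)).mul_const Complex.I
    convert! (h1.cexp.sub_const 1).sub h1 using 1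
    ring
  have := Convex.norm_image_sub_le_of_norm_hasDerivWithin_le (f := compExp)
    (s := Set.Icc (-|u|) |u|) (x := 0) (y := u) (C := |u|)
    (fun x _ => (hd x).hasDerivWithinAt)
    (fun x hx => by
      rw [norm_mul, Complex.norm_I, mul_one]
      exact (norm_exp_mul_I_sub_one_le x).trans (abs_le.2 hx))
    (convex_Icc _ _) (by simp) ⟨neg_abs_le u, le_abs_self u⟩
  simpa [← sq] using this

/-- Factor `e^{iu} = e^{iv} e^{i(u-v)}`. The bound is a product of two square-integrable quantities,
so Hölder makes `f ↦ ∫ compExp ∘ f` continuous on `L²`. -/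
theorem norm_compExp_sub_le (u v : ℝ) :
    ‖compExp u - compExp v‖ ≤ |u - v| * (|u - v| + |v|) := by
  have : compExp u - compExp v = Complex.exp (v * Complex.I) * compExp (u - v)
      + (u - v : ℝ) * Complex.I * (Complex.exp (v * Complex.I) - 1) := by
    have h : Complex.exp (u * Complex.I)
        = Complex.exp (v * Complex.I) * Complex.exp ((u - v : ℝ) * Complex.I) := by
      rw [← Complex.exp_add]; congr 1; push_cast; ring
    simp only [compExp]
    rw [h]; push_cast; ring
  rw [this]
  refine (norm_add_le _ _).trans ?_
  rw [norm_mul, norm_mul, norm_mul, Complex.norm_exp_ofReal_mul_I, Complex.norm_I,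
    Complex.norm_real, Real.norm_eq_abs, mul_add, one_mul, mul_one, ← sq, sq_abs]
  gcongr
  · exact norm_compExp_le _
  · exact norm_exp_mul_I_sub_one_le v

theorem norm_compExp_add_sq_le {u : ℝ} (hu : |u| ≤ 1) :
    ‖compExp u + (u : ℂ) ^ 2 / 2‖ ≤ |u| ^ 3 := by
  have h := Complex.exp_bound (x := u * Complex.I) (by simpa using hu) (n := 3) (by norm_num)
  simp only [Finset.sum_range_succ, Finset.sum_range_zero, norm_mul, Complex.norm_I,
    Complex.norm_real, Real.norm_eq_abs, mul_one] at h
  norm_num [Nat.factorial, mul_pow] at h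
  have e : compExp u + (u : ℂ) ^ 2 / 2
      = Complex.exp (u * Complex.I) - (1 + u * Complex.I + -(u : ℂ) ^ 2 / 2) := by
    simp only [compExp]; ring
  rw [e]
  refine h.trans ?_
  nlinarith [pow_nonneg (abs_nonneg u) 3]

/-! ### Poisson random measures and simple functions -/

section Poisson

variable {Ω S : Type*} [MeasurableSpace Ω] [MeasurableSpace S] {P : Measure Ω}
  {N : Ω → Measure S} {ν : Measure S}

/-- The Poisson law is carried by `ℕ`. This makes the simple functions in play integrable against
almost every realization of `N`. -/
theorem IsPoissonRandomMeasure.ae_ne_top (hN : IsPoissonRandomMeasure P N ν) {B : Set S}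
    (hB : MeasurableSet B) (hν : ν B ≠ ∞) : ∀ᵐ ω ∂P, N ω B ≠ ∞ := by
  have h : ∀ᵐ x ∂(P.map (fun ω => N ω B)), x ≠ ∞ := by
    rw [hN.law B hB hν]
    refine (ae_map_iff Measurable.of_discrete.aemeasurable
      (measurableSet_singleton (∞ : ℝ≥0∞)).compl).2 ?_
    simp
  exact ae_of_ae_map (hN.measurable B hB).aemeasurable h

theorem IsPoissonRandomMeasure.integral_exp_compensated (hN : IsPoissonRandomMeasure P N ν)
    {B : Set S} (hB : MeasurableSet B) (hν : ν B ≠ ∞) (c : ℝ) :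
    ∫ ω, Complex.exp ((c * compensated N ν B ω : ℝ) * Complex.I) ∂P
      = Complex.exp ((ν.real B : ℂ) * compExp c) := by
  let g : ℝ≥0∞ → ℂ := fun x => Complex.exp ((c * (x.toReal - (ν B).toReal) : ℝ) * Complex.I)
  have hg : Measurable g := by fun_prop
  have h1 : ∫ ω, Complex.exp ((c * compensated N ν B ω : ℝ) * Complex.I) ∂P
      = ∫ x, g x ∂(P.map (fun ω => N ω B)) := by
    rw [integral_map (hN.measurable B hB).aemeasurable hg.aestronglyMeasurable]
    rfl
  rw [h1, hN.law B hB hν, integral_map Measurable.of_discrete.aemeasurable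
    hg.aestronglyMeasurable]
  have h2 : ∀ k : ℕ, g k = Complex.exp (c * (k : ℝ) * Complex.I)
      * Complex.exp (-(c * (ν B).toReal * Complex.I)) := by
    intro k
    simp only [g, ENNReal.toReal_natCast, ← Complex.exp_add]
    congr 1; push_cast; ring
  simp_rw [h2]
  rw [integral_mul_const]
  have h3 := charFun_map_cast_poissonMeasure (ν B).toNNReal c
  rw [charFun_apply_real, integral_map Measurable.of_discrete.aemeasurable (by fun_prop)] at h3
  rw [h3, ← Complex.exp_add]
  congr 1
  simp only [compExp, Measure.real]
  have : (((ν B).toNNReal : ℝ) : ℂ) = ((ν B).toReal : ℂ) := rfl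
  rw [this]
  ring

/-- The characteristic function of the compensated Poisson integral of a simple function. -/
theorem IsPoissonRandomMeasure.integral_exp_simpleFunc [IsProbabilityMeasure P]
    (hN : IsPoissonRandomMeasure P N ν) (f : SimpleFunc S ℝ) (hf : Integrable f ν) :
    ∫ ω, Complex.exp (((∫ x, f x ∂(N ω)) - ∫ x, f x ∂ν : ℝ) * Complex.I) ∂P
      = Complex.exp (∫ x, compExp (f x) ∂ν) := by
  classical
  -- Only nonzero levels are kept: their fibres have finite measure by integrability, while the zero
  -- fibre may have infinite measure and contributes nothing since `compExp 0 = 0`. The fibres are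
  -- disjoint, so the counts on them are independent.
  let K := f.range.filter (fun c => c ≠ 0)
  have hK : ∀ c ∈ K, ν (f ⁻¹' {c}) ≠ ∞ := fun c hc =>
    (f.measure_preimage_lt_top_of_integrable hf (Finset.mem_filter.1 hc).2).ne
  have hae : ∀ᵐ ω ∂P, ∀ c ∈ K, N ω (f ⁻¹' {c}) ≠ ∞ := by
    rw [Filter.eventually_all_finset]
    exact fun c hc => hN.ae_ne_top (f.measurableSet_fiber c) (hK c hc)
  have hsum : ∀ (m : Measure S), (∀ c ∈ K, m (f ⁻¹' {c}) ≠ ∞) →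
      Integrable f m ∧ ∫ x, f x ∂m = ∑ c : K, (m (f ⁻¹' {(c : ℝ)})).toReal * c := by
    intro m hm
    have hint : Integrable f m := by
      rw [SimpleFunc.integrable_iff]
      intro y hy
      by_cases hyr : y ∈ f.range
      · exact (hm y (Finset.mem_filter.2 ⟨hyr, hy⟩)).lt_top
      · rw [SimpleFunc.preimage_eq_empty_iff f y |>.2 (by simpa using hyr)]; simp
    refine ⟨hint, ?_⟩
    rw [SimpleFunc.integral_eq_sum f hint,
      Finset.sum_coe_sort K (fun c => (m (f ⁻¹' {c})).toReal * c), Finset.sum_filter]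
    refine Finset.sum_congr rfl fun c _ => ?_
    split_ifs with h
    · rfl
    · simp [not_not.1 h]
  have hL : ∫ ω, Complex.exp (((∫ x, f x ∂(N ω)) - ∫ x, f x ∂ν : ℝ) * Complex.I) ∂P
      = ∫ ω, ∏ c : K, Complex.exp
          (((c : ℝ) * compensated N ν (f ⁻¹' {(c : ℝ)}) ω : ℝ) * Complex.I) ∂P := by
    refine integral_congr_ae ?_
    filter_upwards [hae] with ω hω
    rw [(hsum _ hω).2, (hsum _ hK).2, ← Complex.exp_sum, ← Finset.sum_mul, ← Complex.ofReal_sum,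
      ← Finset.sum_sub_distrib]
    congr 4
    funext c
    simp only [compensated]; ring
  have hind : iIndepFun (fun (c : K) ω => N ω (f ⁻¹' {(c : ℝ)})) P := by
    let e := Fintype.equivFin K
    have := hN.indep _ (fun i => f ⁻¹' {((e.symm i : K) : ℝ)})
      (fun i => f.measurableSet_fiber _) (fun i j hij => by
        refine Disjoint.preimage _ ?_
        rw [Set.disjoint_singleton]
        exact fun h => hij (e.symm.injective (Subtype.ext h)))
    have h2 := this.precomp e.injective
    simpa using h2
  rw [hL]
  refine (hind.integral_fun_prod_comp (f := fun (c : K) (x : ℝ≥0∞) => Complex.exp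
      (((c : ℝ) * (x.toReal - (ν (f ⁻¹' {(c : ℝ)})).toReal) : ℝ) * Complex.I))
      (fun c => (hN.measurable _ (f.measurableSet_fiber _)).aemeasurable)
      (fun c => Measurable.aestronglyMeasurable (by fun_prop))).trans ?_
  have h3 : ∀ c : K, ∫ ω, Complex.exp (((c : ℝ) * ((N ω (f ⁻¹' {(c : ℝ)})).toReal
        - (ν (f ⁻¹' {(c : ℝ)})).toReal) : ℝ) * Complex.I) ∂P
      = Complex.exp ((ν.real (f ⁻¹' {(c : ℝ)}) : ℂ) * compExp c) := fun c =>
    hN.integral_exp_compensated (f.measurableSet_fiber _) (hK c c.2) c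
  simp_rw [h3]
  rw [← Complex.exp_sum]
  congr 1
  have hg0 : compExp 0 = 0 := compExp_zero
  have hgi : Integrable (f.map compExp) ν := by
    rw [SimpleFunc.integrable_iff_finMeasSupp]
    exact (SimpleFunc.integrable_iff_finMeasSupp.1 hf).map hg0
  have h4 := SimpleFunc.map_integral f compExp hf hg0
  rw [SimpleFunc.integral_eq_integral _ hgi] at h4
  simp only [SimpleFunc.coe_map, Function.comp_apply] at h4
  rw [h4, Finset.sum_coe_sort K (fun c => (ν.real (f ⁻¹' {c}) : ℂ) * compExp c),
    Finset.sum_filter]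
  refine Finset.sum_congr rfl fun c _ => ?_
  split_ifs with h
  · simp
  · simp [not_not.1 h]

end Poisson

/-! ### Passage to the limit in `L²` -/

section L2Limits

variable {S : Type*} [MeasurableSpace S] {ν : Measure S}

theorem integrable_compExp_comp {f : S → ℝ} (hf : MemLp f 2 ν) :
    Integrable (fun x => compExp (f x)) ν := by
  refine hf.integrable_sq.mono' (continuous_compExp.comp_aestronglyMeasurable hf.1) ?_
  exact ae_of_all _ fun x => norm_compExp_le _

theorem tendsto_integral_compExp {f : S → ℝ} {F : ℕ → S → ℝ} (hf : MemLp f 2 ν)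
    (hF : ∀ n, MemLp (F n) 2 ν)
    (h : Tendsto (fun n => eLpNorm (F n - f) 2 ν) atTop (𝓝 0)) :
    Tendsto (fun n => ∫ x, compExp (F n x) ∂ν) atTop (𝓝 (∫ x, compExp (f x) ∂ν)) := by
  refine tendsto_integral_of_L1' _ (integrable_compExp_comp hf).1
    (Eventually.of_forall fun n => integrable_compExp_comp (hF n)) ?_
  have hbound : ∀ n, eLpNorm ((fun x => compExp (F n x)) - fun x => compExp (f x)) 1 ν
      ≤ eLpNorm (F n - f) 2 ν * (eLpNorm (F n - f) 2 ν + eLpNorm f 2 ν) := by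
    intro n
    have hd : AEStronglyMeasurable (F n - f) ν := (hF n).1.sub hf.1
    calc eLpNorm ((fun x => compExp (F n x)) - fun x => compExp (f x)) 1 ν
        ≤ eLpNorm ((F n - f) • (fun x => ‖(F n - f) x‖ + ‖f x‖)) 1 ν := by
          refine eLpNorm_mono fun x => ?_
          simp only [Pi.sub_apply, Pi.smul_apply', smul_eq_mul, norm_mul, Real.norm_eq_abs]
          rw [abs_of_nonneg (by positivity : 0 ≤ |F n x - f x| + |f x|)]
          exact norm_compExp_sub_le _ _
      _ ≤ eLpNorm (F n - f) 2 ν * eLpNorm (fun x => ‖(F n - f) x‖ + ‖f x‖) 2 ν :=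
          eLpNorm_smul_le_mul_eLpNorm (hd.norm.add hf.1.norm) hd
      _ ≤ _ := by
          gcongr
          refine (eLpNorm_add_le hd.norm hf.1.norm (by norm_num)).trans ?_
          rw [eLpNorm_norm, eLpNorm_norm]
  refine tendsto_of_tendsto_of_tendsto_of_le_of_le tendsto_const_nhds ?_ (fun _ => zero_le)
    hbound
  have := ENNReal.Tendsto.mul h (Or.inr (by simp [hf.2.ne]))
    (h.add_const (eLpNorm f 2 ν)) (Or.inr (by simp))
  simpa using this

/-- The map `u ↦ e^{iu}` is 1-Lipschitz, and on a probability space `L²` convergence implies `L¹`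
convergence. -/
theorem tendsto_integral_exp_mul_I [IsProbabilityMeasure ν] {ι : Type*} {l : Filter ι}
    {f : S → ℝ} {F : ι → S → ℝ}
    (hf : AEStronglyMeasurable f ν) (hF : ∀ n, AEStronglyMeasurable (F n) ν)
    (h : Tendsto (fun n => eLpNorm (F n - f) 2 ν) l (𝓝 0)) :
    Tendsto (fun n => ∫ x, Complex.exp (F n x * Complex.I) ∂ν) l
      (𝓝 (∫ x, Complex.exp (f x * Complex.I) ∂ν)) := by
  have hint : ∀ {g : S → ℝ}, AEStronglyMeasurable g ν →
      Integrable (fun x => Complex.exp (g x * Complex.I)) ν := fun {g} hg =>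
    Integrable.of_bound ((by fun_prop : Continuous fun u : ℝ =>
      Complex.exp (u * Complex.I)).comp_aestronglyMeasurable hg) 1
      (ae_of_all _ fun x => by simp [Complex.norm_exp_ofReal_mul_I])
  refine tendsto_integral_of_L1' _ (hint hf).1 (Eventually.of_forall fun n => hint (hF n)) ?_
  refine tendsto_of_tendsto_of_tendsto_of_le_of_le tendsto_const_nhds h (fun _ => zero_le)
    fun n => ?_
  refine le_trans (eLpNorm_mono (g := F n - f) fun x => ?_)
    (eLpNorm_le_eLpNorm_of_exponent_le (by norm_num) ((hF n).sub hf))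
  have : Complex.exp (F n x * Complex.I) - Complex.exp (f x * Complex.I)
      = Complex.exp (f x * Complex.I) * (Complex.exp ((F n x - f x : ℝ) * Complex.I) - 1) := by
    rw [mul_sub, ← Complex.exp_add, mul_one]; congr 2; push_cast; ring
  simp only [Pi.sub_apply]
  rw [this, norm_mul, Complex.norm_exp_ofReal_mul_I, one_mul]
  exact norm_exp_mul_I_sub_one_le _

theorem tendsto_eLpNorm_sum_inner {J : Type*} [Fintype J] {p : ℕ}
    {u : J → ℕ → S → EuclideanSpace ℝ (Fin p)} {w : J → S → EuclideanSpace ℝ (Fin p)}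
    (hu : ∀ j n, AEStronglyMeasurable (u j n) ν) (hw : ∀ j, AEStronglyMeasurable (w j) ν)
    (h : ∀ j, Tendsto (fun n => eLpNorm (fun x => u j n x - w j x) 2 ν) atTop (𝓝 0))
    (θ : J → EuclideanSpace ℝ (Fin p)) :
    Tendsto (fun n => eLpNorm ((fun x => ∑ j, inner ℝ (θ j) (u j n x))
      - fun x => ∑ j, inner ℝ (θ j) (w j x)) 2 ν) atTop (𝓝 0) := by
  have hb : ∀ n, eLpNorm ((fun x => ∑ j, inner ℝ (θ j) (u j n x))
      - fun x => ∑ j, inner ℝ (θ j) (w j x)) 2 ν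
      ≤ ∑ j, ENNReal.ofReal ‖θ j‖ * eLpNorm (fun x => u j n x - w j x) 2 ν := by
    intro n
    have e : ((fun x => ∑ j, inner ℝ (θ j) (u j n x)) - fun x => ∑ j, inner ℝ (θ j) (w j x))
        = ∑ j, fun x => inner ℝ (θ j) (u j n x - w j x) := by
      funext x
      simp [inner_sub_right, Finset.sum_sub_distrib]
    rw [e]
    refine (eLpNorm_sum_le (fun j _ => ?_) (by norm_num)).trans ?_
    · exact aestronglyMeasurable_const.inner ((hu j n).sub (hw j))
    · refine Finset.sum_le_sum fun j _ => ?_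
      exact eLpNorm_le_mul_eLpNorm_of_ae_le_mul
        (ae_of_all _ fun x => norm_inner_le_norm _ _) 2
  refine tendsto_of_tendsto_of_tendsto_of_le_of_le tendsto_const_nhds ?_ (fun _ => zero_le) hb
  have : Tendsto (fun n => ∑ j, ENNReal.ofReal ‖θ j‖ *
      eLpNorm (fun x => u j n x - w j x) 2 ν) atTop
      (𝓝 (∑ j, ENNReal.ofReal ‖θ j‖ * 0)) :=
    tendsto_finsetSum _ fun j _ => ENNReal.Tendsto.const_mul (h j) (Or.inr (by simp))
  simpa using this

end L2Limits

/-! ### Characteristic functions of compensated Poisson integrals -/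

section StochIntegral

variable {Ω Z J : Type*} [MeasurableSpace Ω] [MeasurableSpace Z] [Fintype J] {p : ℕ}
  {P : Measure Ω} {N : Ω → Measure (ℝ × Z)} {ν : Measure (ℝ × Z)}

theorem Elementary.measurableSet (e : Elementary ν p) (i : Fin e.size) :
    MeasurableSet (e.left i ×ˢ e.right i) :=
  (e.measurableSet_left i).prod (e.measurableSet_right i)

/-- The rectangles of an elementary function may overlap. As a simple function it has disjoint level
sets, on which independence of `N` can be used. -/
theorem Elementary.exists_simpleFunc (e : Elementary ν p) (θ : EuclideanSpace ℝ (Fin p)) :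
    ∃ f : SimpleFunc (ℝ × Z) ℝ, ∀ x, f x = inner ℝ θ (e.toFun x) := by
  classical
  have h : ∀ s : Finset (Fin e.size), ∃ f : SimpleFunc (ℝ × Z) ℝ, ∀ x, f x =
      inner ℝ θ (∑ i ∈ s, (e.left i ×ˢ e.right i).indicator (fun _ => e.coef i) x) := by
    intro s
    induction s using Finset.induction_on with
    | empty => exact ⟨0, fun x => by simp⟩
    | insert i s hi ih =>
      obtain ⟨f, hf⟩ := ih
      refine ⟨SimpleFunc.piecewise _ (e.measurableSet i)
        (SimpleFunc.const _ (inner ℝ θ (e.coef i))) 0 + f, fun x => ?_⟩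
      rw [Finset.sum_insert hi, inner_add_right, ← hf]
      by_cases hx : x ∈ e.left i ×ˢ e.right i <;> simp [hx]
  exact h Finset.univ

theorem exists_simpleFunc_sum (e : J → Elementary ν p) (θ : J → EuclideanSpace ℝ (Fin p)) :
    ∃ f : SimpleFunc (ℝ × Z) ℝ, ∀ x, f x = ∑ j, inner ℝ (θ j) ((e j).toFun x) := by
  classical
  choose f hf using fun j => (e j).exists_simpleFunc (θ j)
  have h : ∀ s : Finset J, ∃ g : SimpleFunc (ℝ × Z) ℝ, ∀ x, g x =
      ∑ j ∈ s, inner ℝ (θ j) ((e j).toFun x) := by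
    intro s
    induction s using Finset.induction_on with
    | empty => exact ⟨0, fun x => by simp⟩
    | insert i s hi ih =>
      obtain ⟨g, hg⟩ := ih
      exact ⟨f i + g, fun x => by rw [Finset.sum_insert hi, ← hg, ← hf]; rfl⟩
  exact h Finset.univ

/-- The measure `m` is arbitrary so that the formula serves both for `ν` and for a realization `N
ω`; the difference of the two is the compensated integral. -/
theorem Elementary.integrable_inner (e : Elementary ν p) (θ : EuclideanSpace ℝ (Fin p))
    {m : Measure (ℝ × Z)} (hm : ∀ i, m (e.left i ×ˢ e.right i) ≠ ∞) :
    Integrable (fun x => (inner ℝ θ (e.toFun x) : ℝ)) m ∧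
      ∫ x, inner ℝ θ (e.toFun x) ∂m
        = ∑ i, (m (e.left i ×ˢ e.right i)).toReal * inner ℝ θ (e.coef i) := by
  have h : ∀ x, inner ℝ θ (e.toFun x)
      = ∑ i, (e.left i ×ˢ e.right i).indicator (fun _ => (inner ℝ θ (e.coef i) : ℝ)) x := by
    intro x
    rw [Elementary.toFun, inner_sum]
    refine Finset.sum_congr rfl fun i _ => ?_
    by_cases hx : x ∈ e.left i ×ˢ e.right i <;> simp [Set.indicator, hx]
  have hi : ∀ i, Integrable ((e.left i ×ˢ e.right i).indicator
      (fun _ => (inner ℝ θ (e.coef i) : ℝ))) m := fun i =>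
    (integrable_indicator_iff (e.measurableSet i)).2 (integrableOn_const (hm i))
  simp_rw [h]
  refine ⟨integrable_finsetSum _ fun i _ => hi i, ?_⟩
  rw [integral_finsetSum _ fun i _ => hi i]
  refine Finset.sum_congr rfl fun i _ => ?_
  rw [integral_indicator (e.measurableSet i), setIntegral_const]
  rfl

theorem Elementary.memLp_toFun (e : Elementary ν p) : MemLp e.toFun 2 ν := by
  unfold Elementary.toFun
  exact memLp_finsetSum _ fun i _ => memLp_indicator_const _ (e.measurableSet i) _
    (Or.inr (e.finite i))

theorem IsPoissonRandomMeasure.measurable_integral (hN : IsPoissonRandomMeasure P N ν)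
    (e : Elementary ν p) : Measurable (e.integral N) := by
  unfold Elementary.integral compensated
  refine Finset.measurable_sum _ fun i _ => Measurable.smul_const ?_ _
  exact ((hN.measurable _ (e.measurableSet i)).ennreal_toReal).sub_const _

theorem fddCharFun_elementary [IsProbabilityMeasure P] (hN : IsPoissonRandomMeasure P N ν)
    (e : J → Elementary ν p) (θ : J → EuclideanSpace ℝ (Fin p)) :
    ∫ ω, Complex.exp ((∑ j, inner ℝ (θ j) ((e j).integral N ω) : ℝ) * Complex.I) ∂P
      = Complex.exp (∫ x, compExp (∑ j, inner ℝ (θ j) ((e j).toFun x)) ∂ν) := by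
  obtain ⟨f, hf⟩ := exists_simpleFunc_sum e θ
  have hsum : ∀ m : Measure (ℝ × Z), (∀ j i, m ((e j).left i ×ˢ (e j).right i) ≠ ∞) →
      Integrable f m ∧ ∫ x, f x ∂m = ∑ j, ∑ i,
        (m ((e j).left i ×ˢ (e j).right i)).toReal * inner ℝ (θ j) ((e j).coef i) := by
    intro m hm
    have hfe : (f : ℝ × Z → ℝ) = fun x => ∑ j, inner ℝ (θ j) ((e j).toFun x) := funext hf
    rw [hfe]
    have hi := fun j => (e j).integrable_inner (θ j) (hm j)
    refine ⟨integrable_finsetSum _ fun j _ => (hi j).1, ?_⟩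
    rw [integral_finsetSum _ fun j _ => (hi j).1]
    exact Finset.sum_congr rfl fun j _ => (hi j).2
  have hν := hsum ν fun j i => (e j).finite i
  simp_rw [← hf]
  rw [← hN.integral_exp_simpleFunc f hν.1]
  refine integral_congr_ae ?_
  have hae : ∀ᵐ ω ∂P, ∀ j i, N ω ((e j).left i ×ˢ (e j).right i) ≠ ∞ := by
    simp_rw [ae_all_iff]
    exact fun j i => hN.ae_ne_top ((e j).measurableSet i) ((e j).finite i)
  filter_upwards [hae] with ω hω
  rw [(hsum _ hω).2, hν.2, ← Finset.sum_sub_distrib]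
  congr 3
  refine Finset.sum_congr rfl fun j _ => ?_
  rw [← Finset.sum_sub_distrib, Elementary.integral, inner_sum]
  refine Finset.sum_congr rfl fun i _ => ?_
  rw [inner_smul_right, compensated]
  ring

theorem memLp_sum_inner {S : Type*} [MeasurableSpace S] {m : Measure S}
    {w : J → S → EuclideanSpace ℝ (Fin p)} (hw : ∀ j, MemLp (w j) 2 m)
    (θ : J → EuclideanSpace ℝ (Fin p)) :
    MemLp (fun x => ∑ j, inner ℝ (θ j) (w j x)) 2 m :=
  memLp_finsetSum _ fun j _ => (hw j).const_inner (θ j)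

/-- The characteristic function of a process of stochastic integrals with respect to a
compensated Poisson random measure. -/
theorem fddCharFun_stochIntegral [IsProbabilityMeasure P] (hN : IsPoissonRandomMeasure P N ν)
    {φ : ℝ → ℝ × Z → EuclideanSpace ℝ (Fin p)} {Y : ℝ → Ω → EuclideanSpace ℝ (Fin p)}
    (hY : ∀ t, IsStochIntegral P N ν (φ t) (Y t)) (t : J → ℝ)
    (θ : J → EuclideanSpace ℝ (Fin p)) :
    fddCharFun P Y t θ = Complex.exp (∫ x, compExp (∑ j, inner ℝ (θ j) (φ (t j) x)) ∂ν) := by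
  choose hφ hYL e he1 he2 using fun j => hY (t j)
  -- The identity for elementary functions passes to the limit on both sides: the exponent along
  -- convergence in `L²(ν)`, the expectation along convergence in `L²(P)`.
  have h1 := tendsto_integral_compExp (memLp_sum_inner hφ θ)
    (fun n => memLp_sum_inner (fun j => (e j n).memLp_toFun) θ)
    (tendsto_eLpNorm_sum_inner (fun j n => (e j n).memLp_toFun.1) (fun j => (hφ j).1) he1 θ)
  have hm : ∀ j n, AEStronglyMeasurable ((e j n).integral N) P := fun j n =>
    (hN.measurable_integral _).aestronglyMeasurable
  have h2 := tendsto_integral_exp_mul_I (memLp_sum_inner hYL θ).1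
    (fun n => Finset.aestronglyMeasurable_fun_sum _ fun j _ =>
      (aestronglyMeasurable_const (b := θ j)).inner (hm j n))
    (tendsto_eLpNorm_sum_inner hm (fun j => (hYL j).1) he2 θ)
  simp_rw [fddCharFun_elementary hN] at h2
  exact tendsto_nhds_unique h2 ((Complex.continuous_exp.tendsto _).comp h1)

end StochIntegral

/-! ### Isonormal Gaussian processes -/

section WhiteNoise

/-- The law of a family of independent standard normal variables. -/
def stdNormalFamily (ι : Type*) : Measure (ι → ℝ) :=
  Measure.infinitePi fun _ => gaussianReal 0 1

instance (ι : Type*) : IsProbabilityMeasure (stdNormalFamily ι) := by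
  unfold stdNormalFamily; infer_instance

variable {ι : Type*}

theorem measurePreserving_eval_stdNormalFamily (i : ι) :
    MeasurePreserving (Function.eval i) (stdNormalFamily ι) (gaussianReal 0 1) :=
  measurePreserving_eval_infinitePi (fun _ : ι => gaussianReal 0 1) i

theorem iIndepFun_eval_stdNormalFamily :
    iIndepFun (fun (i : ι) (ω : ι → ℝ) => ω i) (stdNormalFamily ι) :=
  iIndepFun_infinitePi (P := fun _ : ι => gaussianReal 0 1) (X := fun _ ω => ω)
    (fun _ => measurable_id)

theorem memLp_eval_stdNormalFamily (i : ι) :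
    MemLp (fun ω : ι → ℝ => ω i) 2 (stdNormalFamily ι) :=
  (memLp_id_gaussianReal 2).comp_measurePreserving (measurePreserving_eval_stdNormalFamily i)

theorem integral_eval_stdNormalFamily (i : ι) : ∫ ω, ω i ∂(stdNormalFamily ι) = 0 := by
  have h := integral_map (measurable_pi_apply i).aemeasurable
    (μ := stdNormalFamily ι) (f := fun x : ℝ => x) (by fun_prop)
  rw [(measurePreserving_eval_stdNormalFamily i).map_eq, integral_id_gaussianReal] at h
  exact h.symm

theorem orthonormal_eval_stdNormalFamily :
    Orthonormal ℝ (fun i : ι => (memLp_eval_stdNormalFamily i).toLp) := by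
  classical
  rw [orthonormal_iff_ite]
  intro i j
  have h : inner ℝ (memLp_eval_stdNormalFamily i).toLp (memLp_eval_stdNormalFamily j).toLp
      = ∫ ω, ω i * ω j ∂(stdNormalFamily ι) := by
    rw [L2.inner_def]
    refine integral_congr_ae ?_
    filter_upwards [(memLp_eval_stdNormalFamily i).coeFn_toLp,
      (memLp_eval_stdNormalFamily j).coeFn_toLp] with ω h1 h2
    rw [h1, h2]
    simp [mul_comm]
  rw [h]
  split_ifs with hij
  · subst hij
    have h1 := integral_map (measurable_pi_apply i).aemeasurable
      (μ := stdNormalFamily ι) (f := fun x : ℝ => x ^ 2) (by fun_prop)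
    have h2 := variance_fun_id_gaussianReal (μ := 0) (v := 1)
    rw [variance_eq_integral measurable_id'.aemeasurable] at h2
    simp only [integral_id_gaussianReal, sub_zero, NNReal.coe_one] at h2
    rw [(measurePreserving_eval_stdNormalFamily i).map_eq, h2] at h1
    simp_rw [← sq]
    exact h1.symm
  · have := (iIndepFun_eval_stdNormalFamily.indepFun hij).integral_mul_eq_mul_integral
      (measurable_pi_apply i).aestronglyMeasurable (measurable_pi_apply j).aestronglyMeasurable
    simpa [integral_eval_stdNormalFamily] using this

theorem integral_exp_sum_stdNormalFamily (s : Finset ι) (c : ι → ℝ) :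
    ∫ ω, Complex.exp ((∑ i ∈ s, c i * ω i : ℝ) * Complex.I) ∂(stdNormalFamily ι)
      = Complex.exp (-((∑ i ∈ s, c i ^ 2 : ℝ) : ℂ) / 2) := by
  have hind := (iIndepFun_eval_stdNormalFamily (ι := ι)).precomp (g := ((↑) : s → ι))
    Subtype.val_injective
  have h1 : ∀ ω : ι → ℝ, Complex.exp ((∑ i ∈ s, c i * ω i : ℝ) * Complex.I)
      = ∏ i : s, Complex.exp (c i * ω i * Complex.I) := by
    intro ω
    rw [← Complex.exp_sum, ← Finset.sum_coe_sort s (fun i => c i * ω i), Complex.ofReal_sum,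
      Finset.sum_mul]
    simp
  simp_rw [h1]
  refine (hind.integral_fun_prod_comp (f := fun (i : s) (x : ℝ) => Complex.exp (c i * x * Complex.I))
    (fun i => (measurable_pi_apply _).aemeasurable)
    (fun i => Measurable.aestronglyMeasurable (by fun_prop))).trans ?_
  have h2 : ∀ i : s, ∫ ω : ι → ℝ, Complex.exp (c i * ω i * Complex.I) ∂(stdNormalFamily ι)
      = Complex.exp (-((c i : ℂ) ^ 2) / 2) := by
    intro i
    have h3 := charFun_gaussianReal (μ := 0) (v := 1) (c i)
    rw [charFun_apply_real, ← (measurePreserving_eval_stdNormalFamily (i : ι)).map_eq,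
      integral_map (measurable_pi_apply _).aemeasurable (by fun_prop)] at h3
    refine h3.trans ?_
    congr 1
    simp
    ring
  simp_rw [h2]
  rw [← Complex.exp_sum, ← Finset.sum_coe_sort s (fun i => c i ^ 2), Complex.ofReal_sum,
    ← Finset.sum_neg_distrib, Finset.sum_div]
  simp

/-- On a suitable probability space there is an isonormal Gaussian process indexed by a given
real Hilbert space. -/
theorem exists_isonormal (E : Type) [NormedAddCommGroup E] [InnerProductSpace ℝ E]
    [CompleteSpace E] :
    ∃ (Ω : Type) (_ : MeasurableSpace Ω) (P : Measure Ω) (_ : IsProbabilityMeasure P)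
      (W : E →ₗ[ℝ] Lp ℝ 2 P), ∀ h, P.map (W h) = gaussianReal 0 (‖h‖ ^ 2).toNNReal := by
  obtain ⟨w, b, -⟩ := exists_hilbertBasis ℝ E
  -- `W` sends a Hilbert basis to independent standard normal coordinates. Thus `W h` is an `L²`
  -- limit of finite Gaussian sums whose variances tend to `‖h‖²` by Parseval.
  let W : E →ₗᵢ[ℝ] Lp ℝ 2 (stdNormalFamily w) :=
    (orthonormal_eval_stdNormalFamily (ι := w)).orthogonalFamily.linearIsometry.comp
      b.repr.toLinearIsometry
  have hW : ∀ h, ∫ ω, Complex.exp (W h ω * Complex.I) ∂(stdNormalFamily w)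
      = Complex.exp (-((‖h‖ ^ 2 : ℝ) : ℂ) / 2) := by
    intro h
    have hs : HasSum (fun i => b.repr h i • (memLp_eval_stdNormalFamily i).toLp) (W h) := by
      have := (orthonormal_eval_stdNormalFamily (ι := w)).orthogonalFamily.hasSum_linearIsometry
        (b.repr h)
      exact this
    have ht : Tendsto (fun s : Finset w => eLpNorm
        ((fun ω : w → ℝ => ∑ i ∈ s, b.repr h i * ω i) - (W h : (w → ℝ) → ℝ)) 2 (stdNormalFamily w))
        atTop (𝓝 0) := by
      have h1 := (Lp.tendsto_Lp_iff_tendsto_eLpNorm' _ _).1 hs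
      refine h1.congr fun s => eLpNorm_congr_ae ?_
      refine EventuallyEq.sub ?_ (EventuallyEq.refl _ _)
      have h2 : ∀ i : w, ∀ᵐ ω ∂(stdNormalFamily w),
          (b.repr h i • (memLp_eval_stdNormalFamily i).toLp : Lp ℝ 2 (stdNormalFamily w)) ω
            = b.repr h i * ω i := by
        intro i
        filter_upwards [Lp.coeFn_smul (b.repr h i) (memLp_eval_stdNormalFamily i).toLp,
          (memLp_eval_stdNormalFamily i).coeFn_toLp] with ω h3 h4
        rw [h3, Pi.smul_apply, h4, smul_eq_mul]
      have h5 : ∀ᵐ ω ∂(stdNormalFamily w), ∀ i ∈ s,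
          (b.repr h i • (memLp_eval_stdNormalFamily i).toLp : Lp ℝ 2 (stdNormalFamily w)) ω
            = b.repr h i * ω i := by
        rw [Filter.eventually_all_finset]
        exact fun i _ => h2 i
      refine (Lp.coeFn_finsetSum s _).trans ?_
      filter_upwards [h5] with ω hω
      rw [Finset.sum_apply]
      exact Finset.sum_congr rfl hω
    have h1 := tendsto_integral_exp_mul_I (Lp.aestronglyMeasurable (W h))
      (fun s => (Finset.measurable_sum s fun i _ =>
        (by fun_prop : Measurable fun ω : w → ℝ => b.repr h i * ω i)).aestronglyMeasurable) ht
    simp_rw [integral_exp_sum_stdNormalFamily] at h1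
    have h2 : HasSum (fun i => b.repr h i ^ 2) (‖h‖ ^ 2) := by
      have := b.hasSum_inner_mul_inner h h
      rw [real_inner_self_eq_norm_sq] at this
      refine this.congr_fun fun i => ?_
      rw [b.repr_apply_apply, real_inner_comm, sq]
    refine tendsto_nhds_unique h1 ?_
    have hc : Continuous fun x : ℝ => Complex.exp (-(x : ℂ) / 2) := by fun_prop
    exact (hc.tendsto _).comp h2
  refine ⟨w → ℝ, inferInstance, stdNormalFamily w, inferInstance, W.toLinearMap, fun h => ?_⟩
  have hm : AEMeasurable (W h) (stdNormalFamily w) := (Lp.aestronglyMeasurable _).aemeasurable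
  have := Measure.isProbabilityMeasure_map hm
  refine Measure.ext_of_charFun (μ := (stdNormalFamily w).map (W h)) (funext fun r => ?_)
  rw [charFun_gaussianReal, charFun_apply_real, integral_map hm (by fun_prop)]
  -- By linearity, the expectation of `e^{i W(r h)}` is the characteristic function of `W h` at `r`.
  have h1 := hW (r • h)
  rw [map_smul] at h1
  have h2 : ∫ ω, Complex.exp (r * W h ω * Complex.I) ∂(stdNormalFamily w)
      = ∫ ω, Complex.exp ((r • W h : Lp ℝ 2 (stdNormalFamily w)) ω * Complex.I)
        ∂(stdNormalFamily w) := by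
    refine integral_congr_ae ?_
    filter_upwards [Lp.coeFn_smul r (W h)] with ω hω
    rw [hω]; simp
  rw [h2, h1]
  congr 1
  rw [norm_smul, Real.coe_toNNReal _ (by positivity), mul_pow]
  simp only [Real.norm_eq_abs, sq_abs]
  push_cast; ring

/-- Apply the isonormal process on `L²(ν)` to each coordinate of `φ t`. Linearity carries a
combination of values of `B` back to one element of `L²(ν)`, whose squared norm is the variance. -/
theorem exists_gaussianProcess_of_memLp {S : Type} [MeasurableSpace S] (ν : Measure S) {p : ℕ}
    (φ : ℝ → S → EuclideanSpace ℝ (Fin p)) (hφ : ∀ t, MemLp (φ t) 2 ν) :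
    ∃ (Ω : Type) (_ : MeasurableSpace Ω) (P : Measure Ω) (_ : IsProbabilityMeasure P)
      (B : ℝ → Ω → EuclideanSpace ℝ (Fin p)), (∀ t, AEMeasurable (B t) P) ∧
      ∀ (J : Type) [Fintype J] (t : J → ℝ) (θ : J → EuclideanSpace ℝ (Fin p)),
        P.map (fun ω => ∑ j, inner ℝ (θ j) (B (t j) ω)) =
          gaussianReal 0 (∫ x, (∑ j, inner ℝ (θ j) (φ (t j) x)) ^ 2 ∂ν).toNNReal := by
  obtain ⟨Ω, _, P, _, W, hW⟩ := exists_isonormal (Lp ℝ 2 ν)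
  have hφk : ∀ t k, MemLp (fun x => φ t x k) 2 ν := fun t k =>
    (EuclideanSpace.proj (𝕜 := ℝ) k : EuclideanSpace ℝ (Fin p) →L[ℝ] ℝ).comp_memLp' (hφ t)
  refine ⟨Ω, _, P, ‹_›, fun t ω => WithLp.toLp 2 fun k => W (hφk t k).toLp ω, fun t => ?_, ?_⟩
  · exact (WithLp.measurable_toLp 2 _).comp_aemeasurable (aemeasurable_pi_lambda _ fun k =>
      (Lp.aestronglyMeasurable _).aemeasurable)
  intro J _ t θ
  have coeSum : ∀ {T : Type} [MeasurableSpace T] (m : Measure T) (f : J → Fin p → Lp ℝ 2 m),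
      ((∑ j, ∑ k, θ j k • f j k : Lp ℝ 2 m) : T → ℝ) =ᵐ[m]
        fun x => ∑ j, ∑ k, θ j k * f j k x := by
    intro T _ m f
    have h1 : ∀ᵐ x ∂m, ∀ j k, (θ j k • f j k : Lp ℝ 2 m) x = θ j k * f j k x := by
      simp_rw [ae_all_iff]
      intro j k
      filter_upwards [Lp.coeFn_smul (θ j k) (f j k)] with x hx
      rw [hx]; rfl
    have h2 : ∀ᵐ x ∂m, ∀ j, (∑ k, θ j k • f j k : Lp ℝ 2 m) x
        = ∑ k, (θ j k • f j k : Lp ℝ 2 m) x := by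
      rw [ae_all_iff]
      intro j
      filter_upwards [Lp.coeFn_finsetSum Finset.univ (fun k => θ j k • f j k)] with x hx
      rw [hx, Finset.sum_apply]
    filter_upwards [h1, h2, Lp.coeFn_finsetSum Finset.univ
      (fun j => ∑ k, θ j k • f j k)] with x h3 h4 h5
    rw [h5, Finset.sum_apply]
    exact Finset.sum_congr rfl fun j _ => (h4 j).trans (Finset.sum_congr rfl fun k _ => h3 j k)
  let h : Lp ℝ 2 ν := ∑ j, ∑ k, θ j k • (hφk (t j) k).toLp
  have hWh : W h =ᵐ[P] fun ω => ∑ j, inner ℝ (θ j)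
      (WithLp.toLp 2 fun k => W (hφk (t j) k).toLp ω : EuclideanSpace ℝ (Fin p)) := by
    have : W h = ∑ j, ∑ k, θ j k • W (hφk (t j) k).toLp := by simp [h]
    rw [this]
    filter_upwards [coeSum P fun j k => W (hφk (t j) k).toLp] with ω hω
    rw [hω]
    simp [PiLp.inner_apply, mul_comm]
  rw [← Measure.map_congr hWh, hW]
  congr 2
  rw [← real_inner_self_eq_norm_sq, L2.inner_def]
  refine integral_congr_ae ?_
  have h1 : ∀ᵐ x ∂ν, ∀ j k, ((hφk (t j) k).toLp : Lp ℝ 2 ν) x = φ (t j) x k := by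
    simp_rw [ae_all_iff]
    exact fun j k => (hφk (t j) k).coeFn_toLp
  filter_upwards [h1, coeSum ν fun j k => (hφk (t j) k).toLp] with x h2 h3
  simp only [h]
  rw [h3]
  simp [PiLp.inner_apply, h2, mul_comm, sq]

end WhiteNoise

/-! ### Second-order expansion of the Poisson exponent -/

section SecondOrder

variable {S ι : Type*} [MeasurableSpace S] {ν : Measure S} {l : Filter ι}

/-- Under diffusive scaling, the cumulant functional of a compensated Poisson integral converges
to the one of a Gaussian integral. -/
theorem tendsto_integral_compExp_scaled [l.IsCountablyGenerated] {δ : ι → ℝ}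
    (hδ : Tendsto δ l (𝓝 0)) (hδ0 : ∀ᶠ c in l, δ c ≠ 0) {G : ι → S → ℝ} {V : S → ℝ}
    (hV : MemLp V 2 ν) (hG : ∀ c, AEStronglyMeasurable (G c) ν) (hGV : ∀ c x, |G c x| ≤ V x)
    {q : ℝ} (hq : ∀ᶠ c in l, ∫ x, G c x ^ 2 ∂ν = q) :
    Tendsto (fun c => ((δ c : ℂ) ^ 2)⁻¹ * ∫ x, compExp (δ c * G c x) ∂ν) l
      (𝓝 (-(q : ℂ) / 2)) := by
  have hV0 : ∀ c x, 0 ≤ V x := fun c x => (abs_nonneg _).trans (hGV c x)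
  have hGsq : ∀ c x, G c x ^ 2 ≤ V x ^ 2 := fun c x => sq_le_sq' (by
    have := abs_le.1 (hGV c x); linarith) ((le_abs_self _).trans (hGV c x))
  have hGL : ∀ c, MemLp (G c) 2 ν := fun c => hV.mono (hG c) (ae_of_all _ fun x => by
    rw [Real.norm_eq_abs, Real.norm_eq_abs]; exact (hGV c x).trans (le_abs_self _))
  -- `G c` need not converge pointwise, so only the second-order remainder is shown to vanish; the
  -- quadratic part has integral `q / 2` eventually.
  let D : ι → S → ℂ := fun c x =>
    ((δ c : ℂ) ^ 2)⁻¹ * compExp (δ c * G c x) + (G c x : ℂ) ^ 2 / 2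
  have hbound : ∀ c x, δ c ≠ 0 → ‖((δ c : ℂ) ^ 2)⁻¹ * compExp (δ c * G c x)‖ ≤ V x ^ 2 := by
    intro c x hc
    rw [norm_mul, norm_inv, norm_pow, Complex.norm_real, Real.norm_eq_abs, sq_abs]
    calc (δ c ^ 2)⁻¹ * ‖compExp (δ c * G c x)‖ ≤ (δ c ^ 2)⁻¹ * (δ c * G c x) ^ 2 := by
          gcongr; exact norm_compExp_le _
      _ = G c x ^ 2 := by field_simp
      _ ≤ V x ^ 2 := hGsq c x
  have hDlim : Tendsto (fun c => ∫ x, D c x ∂ν) l (𝓝 (∫ _, (0 : ℂ) ∂ν)) := by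
    refine tendsto_integral_filter_of_dominated_convergence (fun x => 2 * V x ^ 2) ?_ ?_
      (hV.integrable_sq.const_mul 2) ?_
    · refine Eventually.of_forall fun c => AEStronglyMeasurable.add ?_ ?_
      · exact (continuous_compExp.comp_aestronglyMeasurable ((hG c).const_mul _)).const_mul _
      · exact (by fun_prop : Continuous fun u : ℝ => (u : ℂ) ^ 2 / 2).comp_aestronglyMeasurable
          (hG c)
    · filter_upwards [hδ0] with c hc
      refine ae_of_all _ fun x => (norm_add_le _ _).trans ?_
      have h1 := hbound c x hc
      have h2 : ‖(G c x : ℂ) ^ 2 / 2‖ ≤ V x ^ 2 := by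
        rw [norm_div, norm_pow, Complex.norm_real, Real.norm_eq_abs, sq_abs]
        have := hGsq c x
        simp only [Complex.norm_ofNat]
        nlinarith [sq_nonneg (G c x)]
      linarith
    · refine ae_of_all _ fun x => ?_
      -- Once `|δ c| V x ≤ 1`, Taylor's bound gives `‖D c x‖ ≤ |δ c| V x ^ 3`. Since `V ^ 3` need
      -- not be integrable, this yields only the pointwise limit; domination uses `2 V ^ 2`.
      have hlim : Tendsto (fun c => |δ c| * V x ^ 3) l (𝓝 0) := by
        simpa using (hδ.abs.mul_const (V x ^ 3))
      have hsmall : ∀ᶠ c in l, |δ c| * V x ≤ 1 := by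
        have : Tendsto (fun c => |δ c| * V x) l (𝓝 0) := by simpa using hδ.abs.mul_const (V x)
        exact this.eventually_le_const zero_lt_one
      refine squeeze_zero_norm' ?_ hlim
      filter_upwards [hδ0, hsmall] with c hc hs
      have h1 : |δ c * G c x| ≤ |δ c| * V x := by
        rw [abs_mul]; exact mul_le_mul_of_nonneg_left (hGV c x) (abs_nonneg _)
      have h2 := norm_compExp_add_sq_le (h1.trans hs)
      have h3 : D c x = ((δ c : ℂ) ^ 2)⁻¹ *
          (compExp (δ c * G c x) + ((δ c * G c x : ℝ) : ℂ) ^ 2 / 2) := by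
        have : (δ c : ℂ) ≠ 0 := by exact_mod_cast hc
        simp only [D]; push_cast; field_simp
      rw [h3, norm_mul, norm_inv, norm_pow, Complex.norm_real, Real.norm_eq_abs]
      have hpos : 0 < |δ c| := abs_pos.2 hc
      calc (|δ c| ^ 2)⁻¹ * ‖compExp (δ c * G c x) + ((δ c * G c x : ℝ) : ℂ) ^ 2 / 2‖
          ≤ (|δ c| ^ 2)⁻¹ * (|δ c| * V x) ^ 3 := by
            gcongr; exact h2.trans (by gcongr)
        _ = |δ c| * V x ^ 3 := by field_simp
  have h0 : Tendsto (fun c => (∫ x, D c x ∂ν) - (q : ℂ) / 2) l (𝓝 (-(q : ℂ) / 2)) := by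
    have := hDlim.sub_const ((q : ℂ) / 2)
    simpa [neg_div] using this
  refine h0.congr' ?_
  filter_upwards [hq, hδ0] with c hc hc0
  have hi1 : Integrable (fun x => ((δ c : ℂ) ^ 2)⁻¹ * compExp (δ c * G c x)) ν :=
    (integrable_compExp_comp ((hGL c).const_mul (δ c))).const_mul _
  have hi2 : Integrable (fun x => (G c x : ℂ) ^ 2 / 2) ν := by
    have := ((hGL c).integrable_sq.ofReal (𝕜 := ℂ)).div_const 2
    simpa using this
  have hsq : ∫ x, (G c x : ℂ) ^ 2 / 2 ∂ν = (q : ℂ) / 2 := by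
    rw [integral_div, ← hc, ← integral_complex_ofReal]
    simp
  simp only [D]
  rw [integral_add hi1 hi2, hsq, integral_const_mul]
  ring

end SecondOrder

/-! ### Linear images and increments -/

section CharFunTransforms

variable {Ω J : Type*} [MeasurableSpace Ω] [Fintype J] {p : ℕ}

theorem inner_toEuclideanLin (M : Matrix (Fin p) (Fin p) ℝ) (θ v : EuclideanSpace ℝ (Fin p)) :
    inner ℝ θ (Matrix.toEuclideanLin M v) = inner ℝ (Matrix.toEuclideanLin M.transpose θ) v := by
  rw [← Matrix.conjTranspose_eq_transpose_of_trivial, Matrix.toEuclideanLin_conjTranspose_eq_adjoint,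
    LinearMap.adjoint_inner_left]

theorem fddCharFun_toEuclideanLin (P : Measure Ω) (X : ℝ → Ω → EuclideanSpace ℝ (Fin p))
    (M : Matrix (Fin p) (Fin p) ℝ) (t : J → ℝ) (θ : J → EuclideanSpace ℝ (Fin p)) :
    fddCharFun P (fun t ω => Matrix.toEuclideanLin M (X t ω)) t θ
      = fddCharFun P X t (fun j => Matrix.toEuclideanLin M.transpose (θ j)) := by
  simp only [fddCharFun, inner_toEuclideanLin]

/-- An increment is a linear combination of two values, so the index set is doubled: the second copy
carries the base time and the opposite weights. -/
theorem fddCharFun_increment (P : Measure Ω) (X : ℝ → Ω → EuclideanSpace ℝ (Fin p))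
    (a : ℝ → ℝ) (s : ℝ) (t : J → ℝ) (θ : J → EuclideanSpace ℝ (Fin p)) :
    fddCharFun P (fun t ω => X (a t) ω - X s ω) t θ
      = fddCharFun P X (Sum.elim (fun j => a (t j)) fun _ => s) (Sum.elim θ fun j => -θ j) := by
  simp only [fddCharFun, Fintype.sum_sum_type, Sum.elim_inl, Sum.elim_inr, inner_sub_right,
    inner_neg_left, Finset.sum_sub_distrib, Finset.sum_neg_distrib, ← sub_eq_add_neg]

theorem aemeasurable_toEuclideanLin {P : Measure Ω} {X : Ω → EuclideanSpace ℝ (Fin p)}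
    (M : Matrix (Fin p) (Fin p) ℝ) (hX : AEMeasurable X P) :
    AEMeasurable (fun ω => Matrix.toEuclideanLin M (X ω)) P :=
  (LinearMap.continuous_of_finiteDimensional _).measurable.comp_aemeasurable hX

end CharFunTransforms

/-! ### The limiting operator fractional Brownian motion -/

section Energy

variable {Ω S J : Type*} [MeasurableSpace Ω] [MeasurableSpace S] [Fintype J] {p : ℕ}

/-- The variance `∫ (∑ j, ⟨θ_j, φ_{t_j}⟩)² dν` of a linear combination of stochastic integrals. -/
def energy (ν : Measure S) (φ : ℝ → S → EuclideanSpace ℝ (Fin p)) (t : J → ℝ)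
    (θ : J → EuclideanSpace ℝ (Fin p)) : ℝ :=
  ∫ x, (∑ j, inner ℝ (θ j) (φ (t j) x)) ^ 2 ∂ν

theorem energy_nonneg (ν : Measure S) (φ : ℝ → S → EuclideanSpace ℝ (Fin p)) (t : J → ℝ)
    (θ : J → EuclideanSpace ℝ (Fin p)) : 0 ≤ energy ν φ t θ :=
  integral_nonneg fun _ => sq_nonneg _

theorem exists_orthogonal_ne_zero {V : Submodule ℝ (EuclideanSpace ℝ (Fin p))} (hV : V ≠ ⊤) :
    ∃ θ ∈ Vᗮ, θ ≠ 0 := by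
  refine Submodule.exists_mem_ne_zero_of_ne_bot fun h => hV ?_
  exact (Submodule.orthogonal_eq_bot_iff).1 h

/-- The law of `⟨θ, X t⟩` has the characteristic function of the point mass at zero. -/
theorem ae_inner_eq_zero_of_fddCharFun_eq_one {P : Measure Ω} [IsProbabilityMeasure P]
    {X : ℝ → Ω → EuclideanSpace ℝ (Fin p)} {t : ℝ} (hX : AEMeasurable (X t) P)
    {θ : EuclideanSpace ℝ (Fin p)}
    (h : ∀ r : ℝ, fddCharFun P X (fun _ : Unit => t) (fun _ => r • θ) = 1) :
    ∀ᵐ ω ∂P, inner ℝ θ (X t ω) = 0 := by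
  have hm : AEMeasurable (fun ω => (inner ℝ θ (X t ω) : ℝ)) P := by fun_prop
  have := Measure.isProbabilityMeasure_map hm
  have hmap : P.map (fun ω => (inner ℝ θ (X t ω) : ℝ)) = Measure.dirac 0 := by
    refine Measure.ext_of_charFun (μ := P.map (fun ω => (inner ℝ θ (X t ω) : ℝ)))
      (funext fun r => ?_)
    rw [charFun_apply_real, integral_map hm (by fun_prop), charFun_dirac]
    have := h r
    simp only [fddCharFun, Finset.univ_unique, Finset.sum_const, Finset.card_singleton, one_smul,
      inner_smul_left] at this
    simpa using this
  have h0 : ∀ᵐ x ∂(P.map (fun ω => (inner ℝ θ (X t ω) : ℝ))), x = 0 := by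
    rw [hmap]; simp
  exact ae_of_ae_map hm h0

variable {ν : Measure S} {φ : ℝ → S → EuclideanSpace ℝ (Fin p)}

/-- A centered Gaussian process whose covariance is that of the kernels `φ` is an operator
fractional Brownian motion as soon as the kernels are self-similar, have stationary increments
and are non-degenerate in `L²`. -/
theorem isOfBm_of_energy {P : Measure Ω} [IsProbabilityMeasure P]
    {B : ℝ → Ω → EuclideanSpace ℝ (Fin p)} (hBm : ∀ t, AEMeasurable (B t) P)
    {H : Matrix (Fin p) (Fin p) ℝ} (hH : ReEigIn H (Set.Ioc 0 1))
    (hB : ∀ (J : Type) [Fintype J] (t : J → ℝ) (θ : J → EuclideanSpace ℝ (Fin p)),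
        P.map (fun ω => ∑ j, inner ℝ (θ j) (B (t j) ω)) =
          gaussianReal 0 (energy ν φ t θ).toNNReal)
    (hBc : ∀ (J : Type) [Fintype J] (t : J → ℝ) (θ : J → EuclideanSpace ℝ (Fin p)),
      fddCharFun P B t θ = Complex.exp (-(energy ν φ t θ : ℂ) / 2))
    (hself : ∀ c : ℝ, 0 < c → ∀ (J : Type) [Fintype J] (t : J → ℝ)
      (θ : J → EuclideanSpace ℝ (Fin p)), energy ν φ (fun j => c * t j) θ
        = energy ν φ t (fun j => Matrix.toEuclideanLin (matPow c H).transpose (θ j)))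
    (hstat : ∀ h : ℝ, ∀ (J : Type) [Fintype J] (t : J → ℝ) (θ : J → EuclideanSpace ℝ (Fin p)),
      energy ν φ (Sum.elim (fun j => t j + h) fun _ => h) (Sum.elim θ fun j => -θ j)
        = energy ν φ (Sum.elim t fun _ => 0) (Sum.elim θ fun j => -θ j))
    (hnd : ∀ t : ℝ, t ≠ 0 → ∀ θ : EuclideanSpace ℝ (Fin p), θ ≠ 0 →
      energy ν φ (fun _ : Unit => t) (fun _ => θ) ≠ 0) :
    IsOfBm P B H where
  hurst := hH
  gaussian := isGaussianProcess_of_fddCharFun hBm fun I θ => ⟨_, hB I (fun i => i) θ⟩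
  proper := by
    -- If `B t` stayed in `V`, a nonzero `θ ⟂ V` would make `⟨θ, B t⟩` a point mass, but a Gaussian
    -- law of positive variance has no atoms.
    intro t ht V hV hVae
    obtain ⟨θ, hθV, hθ⟩ := exists_orthogonal_ne_zero hV
    have hlaw := hB Unit (fun _ => t) (fun _ => θ)
    simp only [Finset.univ_unique, Finset.sum_const, Finset.card_singleton, one_smul] at hlaw
    have hz : (fun ω => (inner ℝ θ (B t ω) : ℝ)) =ᵐ[P] fun _ => 0 := by
      filter_upwards [hVae] with ω hω
      exact Submodule.inner_left_of_mem_orthogonal hω hθV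
    rw [Measure.map_congr hz, Measure.map_const, measure_univ, one_smul] at hlaw
    have hv : (energy ν φ (fun _ : Unit => t) (fun _ => θ)).toNNReal ≠ 0 := by
      have h1 := hnd t ht θ hθ
      have h2 := energy_nonneg ν φ (fun _ : Unit => t) (fun _ => θ)
      simpa using lt_of_le_of_ne h2 h1.symm
    have := nullSingletonClass_gaussianReal (μ := 0) hv
    have h3 : (Measure.dirac (0 : ℝ)) {0} = 0 := by rw [hlaw]; exact measure_singleton 0
    simp at h3
  selfSimilar := by
    intro c hc
    refine fddEq_of_fddCharFun_eq (fun t => hBm _)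
      (fun t => aemeasurable_toEuclideanLin _ (hBm t)) fun I θ => ?_
    rw [fddCharFun_toEuclideanLin, hBc, ← hself c hc, ← hBc]
    rfl
  stationaryIncrements := by
    intro h
    refine fddEq_of_fddCharFun_eq (fun t => (hBm _).sub (hBm _))
      (fun t => (hBm _).sub (hBm _)) fun I θ => ?_
    rw [fddCharFun_increment P B (fun t => t + h) h, fddCharFun_increment P B (fun t => t) 0, hBc,
      hBc, hstat]

end Energy

/-- The Gaussian counterpart of a proper process of compensated Poisson integrals. -/
theorem exists_isOfBm_of_stochIntegral {Ω Ω' : Type*} [MeasurableSpace Ω] [MeasurableSpace Ω']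
    {Z : Type} [MeasurableSpace Z] {p : ℕ} {P : Measure Ω} [IsProbabilityMeasure P]
    {P' : Measure Ω'} [IsProbabilityMeasure P'] {N : Ω' → Measure (ℝ × Z)}
    {ν : Measure (ℝ × Z)} (hN : IsPoissonRandomMeasure P' N ν)
    {φ : ℝ → ℝ × Z → EuclideanSpace ℝ (Fin p)} {X : ℝ → Ω → EuclideanSpace ℝ (Fin p)}
    {Y : ℝ → Ω' → EuclideanSpace ℝ (Fin p)} (hY : ∀ t, IsStochIntegral P' N ν (φ t) (Y t))
    (hXY : FddEq P X P' Y) (hX : IsProper P X)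
    {H : Matrix (Fin p) (Fin p) ℝ} (hH : ReEigIn H (Set.Ioo 0 1))
    (hself : ∀ c : ℝ, 0 < c → ∀ (J : Type) [Fintype J] (t : J → ℝ)
      (θ : J → EuclideanSpace ℝ (Fin p)), energy ν φ (fun j => c * t j) θ
        = energy ν φ t (fun j => Matrix.toEuclideanLin (matPow c H).transpose (θ j)))
    (hstat : ∀ h : ℝ, ∀ (J : Type) [Fintype J] (t : J → ℝ) (θ : J → EuclideanSpace ℝ (Fin p)),
      energy ν φ (Sum.elim (fun j => t j + h) fun _ => h) (Sum.elim θ fun j => -θ j)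
        = energy ν φ (Sum.elim t fun _ => 0) (Sum.elim θ fun j => -θ j)) :
    ∃ (Ω'' : Type) (_ : MeasurableSpace Ω'') (Q : Measure Ω'') (_ : IsProbabilityMeasure Q)
      (B : ℝ → Ω'' → EuclideanSpace ℝ (Fin p)), IsOfBm Q B H ∧ (∀ t, AEMeasurable (B t) Q) ∧
      ∀ (J : Type) [Fintype J] (t : J → ℝ) (θ : J → EuclideanSpace ℝ (Fin p)),
        fddCharFun Q B t θ = Complex.exp (-(energy ν φ t θ : ℂ) / 2) := by
  obtain ⟨Ω'', _, Q, _, B, hBm, hB⟩ := exists_gaussianProcess_of_memLp ν φ fun t => (hY t).1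
  have hBc : ∀ (J : Type) [Fintype J] (t : J → ℝ) (θ : J → EuclideanSpace ℝ (Fin p)),
      fddCharFun Q B t θ = Complex.exp (-(energy ν φ t θ : ℂ) / 2) := by
    intro J _ t θ
    have h1 := charFun_gaussianReal (μ := 0) (v := (energy ν φ t θ).toNNReal) 1
    have hm : AEMeasurable (fun ω => ∑ j, (inner ℝ (θ j) (B (t j) ω) : ℝ)) Q :=
      Finset.aemeasurable_fun_sum _ fun j _ => (hBm (t j)).const_inner
    rw [energy, ← hB J t θ, charFun_apply_real, integral_map hm (by fun_prop),
      ← energy, Real.coe_toNNReal _ (energy_nonneg ν φ t θ)] at h1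
    rw [fddCharFun]
    convert! h1 using 1
    · simp
    · simp [neg_div]
  refine ⟨Ω'', _, Q, ‹_›, B, isOfBm_of_energy hBm
    (fun z hz => Set.Ioo_subset_Ioc_self (hH z hz)) hB hBc hself hstat ?_, hBm, hBc⟩
  -- Zero energy means `⟨θ, φ t⟩ = 0` a.e., so the Poisson exponent vanishes and `X t` lies a.s. in
  -- the hyperplane `θᗮ`, against properness of `X`.
  intro t ht θ hθ h0
  have hL : MemLp (fun x => (inner ℝ θ (φ t x) : ℝ)) 2 ν := (hY t).1.const_inner θ
  have hz : (fun x => (inner ℝ θ (φ t x) : ℝ) ^ 2) =ᵐ[ν] 0 := by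
    rw [energy] at h0
    simp only [Finset.univ_unique, Finset.sum_const, Finset.card_singleton, one_smul] at h0
    exact (integral_eq_zero_iff_of_nonneg (fun _ => sq_nonneg _) hL.integrable_sq).1 h0
  refine hX t ht (ℝ ∙ θ)ᗮ ?_ ?_
  · intro htop
    rw [Submodule.orthogonal_eq_top_iff, Submodule.span_singleton_eq_bot] at htop
    exact hθ htop
  · have h1 := ae_inner_eq_zero_of_fddCharFun_eq_one (P := P) (X := X) (t := t) (θ := θ)
      (hXY.aemeasurable_left t) fun r => by
        rw [hXY.fddCharFun_eq, fddCharFun_stochIntegral hN hY]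
        have : ∫ x, compExp (∑ _j : Unit, inner ℝ (r • θ) (φ t x)) ∂ν = ∫ _, 0 ∂ν := by
          refine integral_congr_ae ?_
          filter_upwards [hz] with x hx
          have hx' : (inner ℝ θ (φ t x) : ℝ) = 0 := by simpa using hx
          simp [inner_smul_left, hx']
        rw [this]; simp
    filter_upwards [h1] with ω hω
    rwa [Submodule.mem_orthogonal_singleton_iff_inner_right]

/-! ### The Fourier transform on `L²` -/

section Fourier
open SchwartzMap
open scoped SchwartzMap

theorem fourier_comp_div (u : 𝓢(ℝ, ℂ)) {c : ℝ} (hc : 0 < c) :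
    ∃ v : 𝓢(ℝ, ℂ), (∀ x, v x = u (x / c)) ∧ ∀ ξ : ℝ, (𝓕 v) ξ = (c : ℂ) * (𝓕 u) (c * ξ) := by
  let g : ℝ ≃L[ℝ] ℝ := ContinuousLinearEquiv.unitsEquivAut ℝ (Units.mk0 c⁻¹ (inv_ne_zero hc.ne'))
  let v := compCLMOfContinuousLinearEquiv ℂ g u
  have hv : ∀ x, v x = u (x / c) := fun x => by
    simp [v, g, div_eq_mul_inv]
  refine ⟨v, hv, fun ξ => ?_⟩
  rw [SchwartzMap.fourier_coe, SchwartzMap.fourier_coe, Real.fourier_eq', Real.fourier_eq']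
  have h := Measure.integral_comp_div (fun y : ℝ =>
    Complex.exp (↑(-2 * Real.pi * inner ℝ y (c * ξ)) * Complex.I) • u y) c
  rw [abs_of_pos hc] at h
  rw [← Complex.real_smul, ← h]
  refine integral_congr_ae (ae_of_all _ fun x => ?_)
  simp only [hv]
  congr 4
  simp
  field_simp

/-- An `L²` function is determined by its tempered distribution, so an identity of `L²` transforms
can be tested on Schwartz functions, where it becomes one between ordinary integrals. -/
theorem integral_fourier_mul {f G : ℝ → ℂ} (hf : MemLp f 2 volume) (hG : MemLp G 2 volume) :
    𝓕 (hf.toLp f) = hG.toLp G ↔ ∀ u : 𝓢(ℝ, ℂ), ∫ x, (𝓕 u) x * f x = ∫ x, u x * G x := by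
  have h1 : ∀ u : 𝓢(ℝ, ℂ), (Lp.toTemperedDistribution (𝓕 (hf.toLp f))) u = ∫ x, (𝓕 u) x * f x := by
    intro u
    rw [← Lp.fourier_toTemperedDistribution_eq, TemperedDistribution.fourier_apply,
      Lp.toTemperedDistribution_apply]
    refine integral_congr_ae ?_
    filter_upwards [hf.coeFn_toLp] with x hx
    rw [hx, smul_eq_mul]
  have h2 : ∀ u : 𝓢(ℝ, ℂ), (Lp.toTemperedDistribution (hG.toLp G)) u = ∫ x, u x * G x := by
    intro u
    rw [Lp.toTemperedDistribution_apply]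
    refine integral_congr_ae ?_
    filter_upwards [hG.coeFn_toLp] with x hx
    rw [hx, smul_eq_mul]
  constructor
  · intro h u
    rw [← h1, ← h2, h]
  · intro h
    have hinj := LinearMap.ker_eq_bot.1
      (Lp.ker_toTemperedDistributionCLM_eq_bot (F := ℂ) (μ := (volume : Measure ℝ)) (p := 2))
    apply hinj
    ext u
    exact (h1 u).trans ((h u).trans (h2 u).symm)

theorem memLp_comp_mul {E : Type*} [NormedAddCommGroup E] {f : ℝ → E} (hf : MemLp f 2 volume)
    {c : ℝ} (hc : c ≠ 0) : MemLp (fun x => f (c * x)) 2 volume := by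
  have hmap : Measure.map (c * ·) (volume : Measure ℝ) = ENNReal.ofReal |c⁻¹| • volume :=
    Real.map_volume_mul_left hc
  have h2 : MemLp f 2 (Measure.map (c * ·) (volume : Measure ℝ)) := by
    rw [hmap]; exact hf.smul_measure ENNReal.ofReal_ne_top
  exact (memLp_map_measure_iff h2.1 (measurable_const_mul c).aemeasurable).1 h2

/-- After testing against a Schwartz function, a change of variables moves the dilation onto the
test function, where `fourier_comp_div` handles it. -/
theorem IsL2Fourier.comp_div {f F : ℝ → ℂ} (h : IsL2Fourier f F) {c : ℝ} (hc : 0 < c) :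
    IsL2Fourier (fun s => f (s / c)) (fun x => c * F (c * x)) := by
  obtain ⟨hf, hF, hfF⟩ := h
  have hf' : MemLp (fun s => f (s / c)) 2 volume := by
    have := memLp_comp_mul hf (inv_ne_zero hc.ne')
    simpa only [div_eq_inv_mul] using this
  have hF' : MemLp (fun ξ : ℝ => (c : ℂ) * F (c * (-(2 * Real.pi * ξ)))) 2 volume := by
    have := (memLp_comp_mul hF hc.ne').const_mul (c : ℂ)
    refine this.congr_norm ?_ ?_
    · convert! this.1 using 4
      ring
    · refine ae_of_all _ fun x => ?_
      congr 3; ring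
  refine ⟨hf', hF', (integral_fourier_mul hf' hF').2 fun u => ?_⟩
  obtain ⟨v, hv, hvF⟩ := fourier_comp_div u hc
  have h1 := (integral_fourier_mul hf hF).1 hfF v
  have h2 := Measure.integral_comp_div (fun y : ℝ => (𝓕 u) (c * y) * f y) c
  have h3 := Measure.integral_comp_div (fun y : ℝ => u y * F (-(2 * Real.pi * (c * y)))) c
  rw [abs_of_pos hc] at h2 h3
  have e1 : ∫ x, (𝓕 u) x * f (x / c) = ∫ x, (𝓕 u) (c * (x / c)) * f (x / c) := by
    congr with x; rw [mul_div_cancel₀ _ hc.ne']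
  have e2 : ∫ x, v x * F (-(2 * Real.pi * x))
      = ∫ x, u (x / c) * F (-(2 * Real.pi * (c * (x / c)))) := by
    congr with x; rw [hv, mul_div_cancel₀ _ hc.ne']
  have e3 : ∫ x, (𝓕 v) x * f x = c • ∫ x, (𝓕 u) (c * x) * f x := by
    rw [← integral_smul]
    congr with x; rw [hvF, Complex.real_smul, mul_assoc]
  have e4 : ∫ x, u x * (c * F (c * (-(2 * Real.pi * x))))
      = c • ∫ x, u x * F (-(2 * Real.pi * (c * x))) := by
    rw [← integral_smul]
    congr with x; rw [Complex.real_smul]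
    have : c * (-(2 * Real.pi * x)) = -(2 * Real.pi * (c * x)) := by ring
    rw [this]; ring
  rw [e1, h2, ← e3, h1, e2, h3, e4]

theorem IsL2Fourier.ae_eq {f f' F : ℝ → ℂ} (h : IsL2Fourier f F) (h' : IsL2Fourier f' F) :
    f =ᵐ[volume] f' := by
  obtain ⟨hf, hF, e⟩ := h
  obtain ⟨hf', hF', e'⟩ := h'
  have : hf.toLp f = hf'.toLp f' :=
    (Lp.fourierTransformₗᵢ ℝ ℂ).injective (e.trans e'.symm)
  exact (MemLp.toLp_eq_toLp_iff hf hf').1 this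

theorem IsL2Fourier.zero : IsL2Fourier (fun _ => 0) (fun _ => 0) := by
  refine ⟨MemLp.zero', MemLp.zero', ?_⟩
  rw [integral_fourier_mul]
  simp

theorem IsL2Fourier.add {f f' F F' : ℝ → ℂ} (h : IsL2Fourier f F) (h' : IsL2Fourier f' F') :
    IsL2Fourier (fun s => f s + f' s) (fun x => F x + F' x) := by
  obtain ⟨hf, hF, e⟩ := h
  obtain ⟨hf', hF', e'⟩ := h'
  refine ⟨hf.add hf', hF.add hF', ?_⟩
  have := congrArg₂ (· + ·) e e'
  rw [← FourierTransform.fourier_add] at this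
  exact this

theorem IsL2Fourier.const_mul {f F : ℝ → ℂ} (h : IsL2Fourier f F) (c : ℂ) :
    IsL2Fourier (fun s => c * f s) (fun x => c * F x) := by
  obtain ⟨hf, hF, e⟩ := h
  refine ⟨hf.const_mul c, hF.const_mul c, ?_⟩
  have := congrArg (c • ·) e
  rw [← FourierTransform.fourier_smul] at this
  exact this

theorem IsL2Fourier.sum {ι : Type*} (s : Finset ι) {f F : ι → ℝ → ℂ}
    (h : ∀ i ∈ s, IsL2Fourier (f i) (F i)) :
    IsL2Fourier (fun x => ∑ i ∈ s, f i x) (fun x => ∑ i ∈ s, F i x) := by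
  classical
  induction s using Finset.induction_on with
  | empty => simpa using IsL2Fourier.zero
  | insert i s hi ih =>
    simp only [Finset.sum_insert hi]
    exact (h i (by simp)).add (ih fun j hj => h j (by simp [hj]))

/-- Parseval's identity. -/
theorem IsL2Fourier.integral_norm_sq {f F : ℝ → ℂ} (h : IsL2Fourier f F) :
    ∫ s, ‖f s‖ ^ 2 = (2 * Real.pi)⁻¹ * ∫ x, ‖F x‖ ^ 2 := by
  obtain ⟨hf, hF, e⟩ := h
  have hn : ∀ {g : ℝ → ℂ} (hg : MemLp g 2 volume), ‖hg.toLp g‖ ^ 2 = ∫ x, ‖g x‖ ^ 2 := by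
    intro g hg
    have h1 := inner_self_eq_norm_sq_to_K (𝕜 := ℂ) (hg.toLp g)
    rw [L2.inner_def] at h1
    have h2 : ∫ x, inner ℂ (hg.toLp g x) (hg.toLp g x) = ((∫ x, ‖g x‖ ^ 2 : ℝ) : ℂ) := by
      rw [← integral_complex_ofReal]
      refine integral_congr_ae ?_
      filter_upwards [hg.coeFn_toLp] with x hx
      rw [hx, inner_self_eq_norm_sq_to_K]
      simp
    rw [h2] at h1
    apply Complex.ofReal_injective
    rw [h1, Complex.ofReal_pow]
    rfl
  rw [← hn hf, ← Lp.norm_fourier_eq, e, hn hF]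
  -- The factor `(2π)⁻¹` is the Jacobian of `x = -2πξ`, which relates the two normalizations of the
  -- transform.
  have := Measure.integral_comp_mul_left (fun y => ‖F y‖ ^ 2) (-(2 * Real.pi))
  simp only [neg_mul] at this
  rw [this, smul_eq_mul]
  congr 1
  rw [inv_neg, abs_neg, abs_of_pos (by positivity)]

end Fourier

/-! ### Matrix powers -/

section MatPow

variable {p : ℕ}

theorem matPow_add {c : ℝ} {M M' : Matrix (Fin p) (Fin p) ℝ} (h : Commute M M') :
    matPow c (M + M') = matPow c M * matPow c M' := by
  unfold matPow
  rw [smul_add, Matrix.exp_add_of_commute]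
  exact (h.smul_left _).smul_right _

theorem matPow_mul {c x : ℝ} (hc : 0 < c) (hx : 0 < x) (M : Matrix (Fin p) (Fin p) ℝ) :
    matPow (c * x) M = matPow c M * matPow x M := by
  unfold matPow
  rw [Real.log_mul hc.ne' hx.ne', add_smul, Matrix.exp_add_of_commute]
  exact ((Commute.refl M).smul_left _).smul_right _

theorem matPow_smul_one {c : ℝ} (hc : 0 < c) (r : ℝ) :
    matPow c (r • (1 : Matrix (Fin p) (Fin p) ℝ)) = (c ^ r) • 1 := by
  unfold matPow
  rw [smul_smul, ← Matrix.diagonal_one, ← Matrix.diagonal_smul, Matrix.exp_diagonal,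
    ← Matrix.diagonal_smul]
  congr 1
  funext i
  rw [Pi.coe_exp]
  simp [Real.rpow_def_of_pos hc, ← Real.exp_eq_exp_ℝ]

theorem matPow_mul_matPow_neg (c : ℝ) (M : Matrix (Fin p) (Fin p) ℝ) :
    matPow c (-M) * matPow c M = 1 := by
  rw [← matPow_add (Commute.refl M).neg_left, neg_add_cancel]
  simp [matPow]

theorem continuous_exp_smul_apply (M : Matrix (Fin p) (Fin p) ℝ) (i k : Fin p) :
    Continuous fun u : ℝ => NormedSpace.exp (u • M) i k := by
  -- An auxiliary operator norm makes continuity of the exponential available; the entrywise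
  -- conclusion does not mention it.
  let _ : NormedRing (Matrix (Fin p) (Fin p) ℝ) := Matrix.linftyOpNormedRing
  let _ : NormedAlgebra ℝ (Matrix (Fin p) (Fin p) ℝ) := Matrix.linftyOpNormedAlgebra
  let _ : NormedAlgebra ℚ (Matrix (Fin p) (Fin p) ℝ) := NormedAlgebra.restrictScalars ℚ ℝ _
  have h : Continuous fun u : ℝ => NormedSpace.exp (u • M) :=
    NormedSpace.exp_continuous.comp (continuous_id.smul continuous_const)
  exact h.matrix_elem i k

theorem measurable_matPow_apply (M : Matrix (Fin p) (Fin p) ℝ) (i k : Fin p) :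
    Measurable fun x : ℝ => matPow x M i k :=
  (continuous_exp_smul_apply M i k).measurable.comp Real.measurable_log

theorem toComplex_mul (M M' : Matrix (Fin p) (Fin p) ℝ) :
    toComplex (M * M') = toComplex M * toComplex M' :=
  Matrix.map_mul (f := Complex.ofRealHom)

theorem ofReal_toEuclideanLin_transpose (M : Matrix (Fin p) (Fin p) ℝ)
    (θ : EuclideanSpace ℝ (Fin p)) :
    (fun i => ((Matrix.toEuclideanLin M.transpose θ i : ℝ) : ℂ))
      = Matrix.vecMul (fun i => (θ i : ℂ)) (toComplex M) := by
  funext i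
  simp [Matrix.toLpLin_apply, Matrix.mulVec, Matrix.vecMul, dotProduct, toComplex, mul_comm]

end MatPow

/-! ### Symmetries of the spectral kernel -/

section HarmKernel

variable {p : ℕ} (H : Matrix (Fin p) (Fin p) ℝ) (A : Matrix (Fin p) (Fin p) ℂ)

/-- Source of stationary increments: `e^{i(t+h)x} - e^{ihx} = e^{ihx}(e^{itx} - 1)`. -/
theorem harmKernel_add_sub (t h x : ℝ) :
    harmKernel H A (t + h) x - harmKernel H A h x
      = Complex.exp (Complex.I * h * x) • harmKernel H A t x := by
  simp only [harmKernel]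
  rw [← sub_smul, smul_smul]
  congr 1
  have : Complex.exp (Complex.I * ↑(t + h) * x)
      = Complex.exp (Complex.I * h * x) * Complex.exp (Complex.I * t * x) := by
    rw [← Complex.exp_add]; congr 1; push_cast; ring
  rw [this]
  ring

/-- Hermitian symmetry is the reason for the conjugate of `A` on the negative half-line. It later
makes products of real and imaginary parts odd. -/
theorem harmKernel_neg_apply (t x : ℝ) (i k : Fin p) :
    harmKernel H A t (-x) i k = (starRingEnd ℂ) (harmKernel H A t x i k) := by
  have hmul : ∀ M : Matrix (Fin p) (Fin p) ℝ, ∀ B : Matrix (Fin p) (Fin p) ℂ,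
      toComplex M * B.map (starRingEnd ℂ) = (toComplex M * B).map (starRingEnd ℂ) := by
    intro M B
    rw [Matrix.map_mul]
    congr 1
    ext i k
    simp [toComplex]
  have hA : (A.map (starRingEnd ℂ)).map (starRingEnd ℂ) = A := by ext i k; simp
  have hs : (Complex.exp (Complex.I * t * ((-x : ℝ) : ℂ)) - 1) / (Complex.I * ((-x : ℝ) : ℂ))
      = (starRingEnd ℂ) ((Complex.exp (Complex.I * t * x) - 1) / (Complex.I * x)) := by
    rw [map_div₀, map_sub, ← Complex.exp_conj]
    simp
  simp only [harmKernel]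
  rw [hs]
  rcases lt_trichotomy x 0 with hx | hx | hx
  · have h1 : 0 < -x := by linarith
    rw [if_pos h1, if_neg hx.not_gt, if_pos hx]
    conv_lhs => rw [← hA, hmul]
    simp only [Matrix.smul_apply, smul_eq_mul, map_mul, Matrix.map_apply]
  · simp [hx]
  · have h1 : ¬ 0 < -x := by linarith
    have h2 : -x < 0 := by linarith
    rw [if_neg h1, if_pos h2, if_pos hx, neg_neg, hmul]
    simp only [Matrix.smul_apply, smul_eq_mul, map_mul, Matrix.map_apply]

/-- Source of self-similarity. Since `H - D = ½ I`, one has `c^H (cx)^{-D} = √c x^{-D}`; rewriting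
`1/(ix)` as `c/(icx)` supplies a factor `c = √c √c`, of which one root is absorbed here and the
other remains. -/
theorem harmKernel_mul {c : ℝ} (hc : 0 < c) (t x : ℝ) :
    harmKernel H A (c * t) x
      = ((Real.sqrt c : ℝ) : ℂ) • (toComplex (matPow c H) * harmKernel H A t (c * x)) := by
  set D : Matrix (Fin p) (Fin p) ℝ := H - (1 / 2 : ℝ) • (1 : Matrix (Fin p) (Fin p) ℝ) with hD
  have hpow : matPow c H * matPow c (-D) = (Real.sqrt c) • 1 := by
    have hcomm : Commute H (-D) := by
      refine Commute.neg_right ?_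
      rw [hD]
      exact (Commute.refl H).sub_right ((Commute.one_right H).smul_right _)
    rw [← matPow_add hcomm, Real.sqrt_eq_rpow, ← matPow_smul_one hc]
    congr 1
    rw [hD]; abel
  have hpos : ∀ y : ℝ, 0 < y → ∀ B : Matrix (Fin p) (Fin p) ℂ,
      toComplex (matPow c H) * (toComplex (matPow (c * y) (-D)) * B)
        = ((Real.sqrt c : ℝ) : ℂ) • (toComplex (matPow y (-D)) * B) := by
    intro y hy B
    rw [matPow_mul hc hy, ← Matrix.mul_assoc, ← toComplex_mul, ← Matrix.mul_assoc, hpow,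
      smul_mul_assoc, one_mul]
    ext i k
    simp [toComplex, Matrix.mul_apply, Finset.mul_sum, mul_assoc]
  have hsq : ((Real.sqrt c : ℝ) : ℂ) * ((Real.sqrt c : ℝ) : ℂ) = c := by
    rw [← Complex.ofReal_mul, Real.mul_self_sqrt hc.le]
  have hc' : (c : ℂ) ≠ 0 := by exact_mod_cast hc.ne'
  have hexp : Complex.exp (Complex.I * ↑(c * t) * x) = Complex.exp (Complex.I * t * ↑(c * x)) := by
    congr 1; push_cast; ring
  have hscal : ∀ E : ℂ, (x : ℂ) ≠ 0 → (E - 1) / (Complex.I * x)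
      = ((Real.sqrt c : ℝ) : ℂ) * ((E - 1) / (Complex.I * ↑(c * x))) * ((Real.sqrt c : ℝ) : ℂ) := by
    intro E hx
    have e : (E - 1) / (Complex.I * x) = (((Real.sqrt c : ℝ) : ℂ) * ((Real.sqrt c : ℝ) : ℂ)) *
        ((E - 1) / (Complex.I * (c * x))) := by
      rw [hsq]; field_simp
    push_cast
    linear_combination e
  simp only [harmKernel, ← hD]
  rw [hexp]
  rcases lt_trichotomy x 0 with hx | hx | hx
  · have h1 : c * x < 0 := mul_neg_of_pos_of_neg hc hx
    rw [if_neg h1.not_gt, if_pos h1, if_neg hx.not_gt, if_pos hx, mul_smul_comm,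
      ← mul_neg, hpos _ (by linarith), smul_smul, smul_smul]
    congr 1
    have hx' : (x : ℂ) ≠ 0 := by exact_mod_cast hx.ne
    exact hscal _ hx'
  · simp [hx]
  · have h1 : 0 < c * x := mul_pos hc hx
    rw [if_pos h1, if_pos hx, mul_smul_comm, hpos _ hx, smul_smul, smul_smul]
    congr 1
    have hx' : (x : ℂ) ≠ 0 := by exact_mod_cast hx.ne'
    exact hscal _ hx'

theorem measurable_harmKernel_apply (t : ℝ) (i k : Fin p) :
    Measurable fun x => harmKernel H A t x i k := by
  have hm : ∀ (M : Matrix (Fin p) (Fin p) ℝ) (B : Matrix (Fin p) (Fin p) ℂ),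
      Measurable fun x : ℝ => (toComplex (matPow x M) * B) i k := by
    intro M B
    simp only [Matrix.mul_apply, toComplex, Matrix.map_apply]
    exact Finset.measurable_sum _ fun l _ =>
      (Complex.measurable_ofReal.comp (measurable_matPow_apply M i l)).mul_const _
  let D : Matrix (Fin p) (Fin p) ℝ := H - (1 / 2 : ℝ) • (1 : Matrix (Fin p) (Fin p) ℝ)
  have h : ∀ x : ℝ, harmKernel H A t x i k =
      (Complex.exp (Complex.I * t * x) - 1) / (Complex.I * x) *
      (if 0 < x then (toComplex (matPow x (-D)) * A) i k
        else if x < 0 then (toComplex (matPow (-x) (-D)) * A.map (starRingEnd ℂ)) i k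
        else 0) := by
    intro x
    simp only [harmKernel, Matrix.smul_apply, smul_eq_mul]
    split_ifs <;> rfl
  simp_rw [h]
  refine Measurable.mul (by fun_prop) ?_
  refine Measurable.ite (measurableSet_lt measurable_const measurable_id) (hm _ _) ?_
  exact Measurable.ite (measurableSet_lt measurable_id measurable_const)
    ((hm _ _).comp measurable_neg) measurable_const

variable {J : Type*} [Fintype J]

/-- The row vector `∑ j, θ_jᵀ g̃_{t_j}(x)`. -/
def specRow (t : J → ℝ) (θ : J → EuclideanSpace ℝ (Fin p)) (x : ℝ) : Fin p → ℂ :=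
  ∑ j, Matrix.vecMul (fun i => (θ j i : ℂ)) (harmKernel H A (t j) x)

theorem specRow_apply (t : J → ℝ) (θ : J → EuclideanSpace ℝ (Fin p)) (x : ℝ) (k : Fin p) :
    specRow H A t θ x k = ∑ j, ∑ i, (θ j i : ℂ) * harmKernel H A (t j) x i k := by
  simp [specRow, Matrix.vecMul, dotProduct]

theorem measurable_specRow (t : J → ℝ) (θ : J → EuclideanSpace ℝ (Fin p)) (k : Fin p) :
    Measurable fun x => specRow H A t θ x k := by
  simp_rw [specRow_apply]
  exact Finset.measurable_sum _ fun j _ => Finset.measurable_sum _ fun i _ =>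
    (measurable_harmKernel_apply H A (t j) i k).const_mul _

theorem specRow_neg (t : J → ℝ) (θ : J → EuclideanSpace ℝ (Fin p)) (x : ℝ) (k : Fin p) :
    specRow H A t θ (-x) k = (starRingEnd ℂ) (specRow H A t θ x k) := by
  simp [specRow_apply, harmKernel_neg_apply]

theorem specRow_mul {c : ℝ} (hc : 0 < c) (t : J → ℝ) (θ : J → EuclideanSpace ℝ (Fin p)) (x : ℝ) :
    specRow H A (fun j => c * t j) θ x = ((Real.sqrt c : ℝ) : ℂ) •
      specRow H A t (fun j => Matrix.toEuclideanLin (matPow c H).transpose (θ j)) (c * x) := by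
  simp only [specRow, Finset.smul_sum]
  refine Finset.sum_congr rfl fun j _ => ?_
  rw [harmKernel_mul H A hc, ofReal_toEuclideanLin_transpose, Matrix.vecMul_smul,
    Matrix.vecMul_vecMul]

theorem specRow_increment (t : J → ℝ) (h : ℝ) (θ : J → EuclideanSpace ℝ (Fin p)) (x : ℝ) :
    specRow H A (Sum.elim (fun j => t j + h) fun _ => h) (Sum.elim θ fun j => -θ j) x
      = Complex.exp (Complex.I * h * x) • specRow H A t θ x := by
  simp only [specRow, Fintype.sum_sum_type, Sum.elim_inl, Sum.elim_inr, Finset.smul_sum]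
  rw [← Finset.sum_add_distrib]
  refine Finset.sum_congr rfl fun j _ => ?_
  have : (fun i => (((-θ j) i : ℝ) : ℂ)) = -fun i => (θ j i : ℂ) := by funext i; simp
  rw [this, Matrix.neg_vecMul, ← sub_eq_add_neg, ← Matrix.vecMul_sub, harmKernel_add_sub,
    Matrix.vecMul_smul]

/-- The variance of a linear combination in the spectral domain, up to normalization. -/
def specEnergy (t : J → ℝ) (θ : J → EuclideanSpace ℝ (Fin p)) : ℝ :=
  ∫ x, ∑ k, ‖specRow H A t θ x k‖ ^ 2

/-- The squared factor `(√c)² = c` cancels the Jacobian of `x ↦ cx`. -/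
theorem specEnergy_mul {c : ℝ} (hc : 0 < c) (t : J → ℝ) (θ : J → EuclideanSpace ℝ (Fin p)) :
    specEnergy H A (fun j => c * t j) θ
      = specEnergy H A t (fun j => Matrix.toEuclideanLin (matPow c H).transpose (θ j)) := by
  simp only [specEnergy]
  have h := Measure.integral_comp_mul_left (fun y => ∑ k, ‖specRow H A t
    (fun j => Matrix.toEuclideanLin (matPow c H).transpose (θ j)) y k‖ ^ 2) c
  rw [abs_of_pos (inv_pos.2 hc), smul_eq_mul, eq_inv_mul_iff_mul_eq₀ hc.ne',
    ← integral_const_mul] at h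
  rw [← h]
  congr with x
  rw [specRow_mul H A hc, Finset.mul_sum]
  refine Finset.sum_congr rfl fun k _ => ?_
  rw [Pi.smul_apply, norm_smul, mul_pow, Complex.norm_real, Real.norm_eq_abs, sq_abs,
    Real.sq_sqrt hc.le]

theorem norm_exp_I_mul_mul (h x : ℝ) : ‖Complex.exp (Complex.I * h * x)‖ = 1 := by
  rw [Complex.norm_exp]; simp

theorem specEnergy_increment (t : J → ℝ) (h : ℝ) (θ : J → EuclideanSpace ℝ (Fin p)) :
    specEnergy H A (Sum.elim (fun j => t j + h) fun _ => h) (Sum.elim θ fun j => -θ j)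
      = specEnergy H A t θ := by
  simp only [specEnergy, specRow_increment, Pi.smul_apply, norm_smul, norm_exp_I_mul_mul, one_mul]

end HarmKernel

/-! ### Lévy measures with second moments and product integrals -/

section SecondMoments

variable {E : Type*} [NormedAddCommGroup E] [MeasurableSpace E] [BorelSpace E]
  [SecondCountableTopology E] {μ : Measure E}

theorem IsLevyMeasure₂.memLp_id (h : IsLevyMeasure₂ μ) : MemLp (fun z : E => z) 2 μ := by
  refine ⟨measurable_id.aestronglyMeasurable, ?_⟩
  rw [eLpNorm_lt_top_iff_lintegral_rpow_enorm_lt_top (by norm_num) (by norm_num)]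
  simpa using h.secondMoment

/-- `μ` may have infinite mass near the origin. Chebyshev bounds the mass outside each ball, and the
origin itself is null. -/
theorem IsLevyMeasure₂.sigmaFinite (h : IsLevyMeasure₂ μ) : SigmaFinite μ := by
  refine ⟨⟨{
    set := fun n => {0} ∪ {z | (n + 1 : ℝ≥0∞)⁻¹ ≤ ‖z‖ₑ}
    set_mem := fun _ => trivial
    finite := fun n => ?_
    spanning := ?_ }⟩⟩
  · refine (measure_union_le _ _).trans_lt ?_
    rw [h.zero, zero_add]
    refine lt_of_le_of_lt ?_ ((ENNReal.mul_lt_top (ENNReal.pow_lt_top (n := 2) (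
      by finiteness : (n + 1 : ℝ≥0∞) < ∞)) h.secondMoment))
    have h1 := meas_ge_le_lintegral_div (μ := μ) (f := fun z : E => ‖z‖ₑ ^ 2)
      (by fun_prop) (ε := ((n + 1 : ℝ≥0∞)⁻¹) ^ 2) (by simp) (by simp)
    refine (measure_mono fun z (hz : (n + 1 : ℝ≥0∞)⁻¹ ≤ ‖z‖ₑ) => ?_).trans (h1.trans ?_)
    · exact pow_le_pow_left' hz 2
    · rw [ENNReal.div_eq_inv_mul, ENNReal.inv_pow, inv_inv]
  · rw [Set.eq_univ_iff_forall]
    intro z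
    rw [Set.mem_iUnion]
    by_cases hz : z = 0
    · exact ⟨0, Or.inl hz⟩
    · obtain ⟨n, hn⟩ := ENNReal.exists_inv_nat_lt (enorm_ne_zero.2 hz)
      refine ⟨n, Or.inr (le_trans ?_ hn.le)⟩
      gcongr
      exact le_self_add

theorem memLp_re_coord {p : ℕ} {μ : Measure (EuclideanSpace ℂ (Fin p))}
    (h : IsLevyMeasure₂ μ) (k : Fin p) :
    MemLp (fun z : EuclideanSpace ℂ (Fin p) => (z k).re) 2 μ :=
  ((EuclideanSpace.proj (𝕜 := ℂ) k : EuclideanSpace ℂ (Fin p) →L[ℂ] ℂ).comp_memLp' h.memLp_id).re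

theorem memLp_im_coord {p : ℕ} {μ : Measure (EuclideanSpace ℂ (Fin p))}
    (h : IsLevyMeasure₂ μ) (k : Fin p) :
    MemLp (fun z : EuclideanSpace ℂ (Fin p) => (z k).im) 2 μ :=
  ((EuclideanSpace.proj (𝕜 := ℂ) k : EuclideanSpace ℂ (Fin p) →L[ℂ] ℂ).comp_memLp' h.memLp_id).im

end SecondMoments

theorem memLp_mul_prod {Z : Type*} [MeasurableSpace Z] {μ : Measure Z} {a : ℝ → ℝ} {b : Z → ℝ}
    (ha : MemLp a 2 volume) (hb : MemLp b 2 μ) :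
    MemLp (fun x : ℝ × Z => a x.1 * b x.2) 2 ((volume : Measure ℝ).prod μ) := by
  refine (memLp_two_iff_integrable_sq (ha.1.comp_fst.mul hb.1.comp_snd)).2 ?_
  have := ha.integrable_sq.mul_prod hb.integrable_sq
  simpa only [mul_pow, Pi.mul_apply] using this

section Product

variable {Z κ : Type*} [MeasurableSpace Z] [Fintype κ] {μ : Measure Z} [SigmaFinite μ]

theorem integral_sum_mul_sq {a : κ → ℝ → ℝ} {b : κ → Z → ℝ}
    (ha : ∀ k, MemLp (a k) 2 volume) (hb : ∀ k, MemLp (b k) 2 μ) :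
    ∫ x, (∑ k, a k x.1 * b k x.2) ^ 2 ∂((volume : Measure ℝ).prod μ)
      = ∑ k, ∑ l, (∫ s, a k s * a l s) * ∫ z, b k z * b l z ∂μ := by
  have h : ∀ x : ℝ × Z, (∑ k, a k x.1 * b k x.2) ^ 2
      = ∑ k, ∑ l, (a k x.1 * a l x.1) * (b k x.2 * b l x.2) := by
    intro x
    rw [sq, Finset.sum_mul_sum]
    refine Finset.sum_congr rfl fun k _ => Finset.sum_congr rfl fun l _ => ?_
    ring
  have hi : ∀ k l, Integrable (fun x : ℝ × Z => (a k x.1 * a l x.1) * (b k x.2 * b l x.2))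
      ((volume : Measure ℝ).prod μ) := fun k l =>
    Integrable.mul_prod (f := fun s => a k s * a l s) (g := fun z => b k z * b l z)
      ((ha k).integrable_mul (ha l)) ((hb k).integrable_mul (hb l))
  simp_rw [h]
  rw [integral_finsetSum _ fun k _ => integrable_finsetSum _ fun l _ => hi k l]
  refine Finset.sum_congr rfl fun k _ => ?_
  rw [integral_finsetSum _ fun l _ => hi k l]
  refine Finset.sum_congr rfl fun l _ => ?_
  exact integral_prod_mul (fun s => a k s * a l s) (fun z => b k z * b l z)

theorem map_prod_mul_left {c : ℝ} (hc : c ≠ 0) :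
    Measure.map (Prod.map (c * ·) id) ((volume : Measure ℝ).prod μ)
      = ENNReal.ofReal |c⁻¹| • (volume : Measure ℝ).prod μ := by
  rw [← Measure.map_prod_map _ _ (measurable_const_mul c) measurable_id,
    Real.map_volume_mul_left hc, Measure.map_id, Measure.prod_smul_left]

theorem integral_prod_comp_mul_left {E : Type*} [NormedAddCommGroup E] [NormedSpace ℝ E]
    {c : ℝ} (hc : 0 < c) (f : ℝ × Z → E) :
    ∫ x, f (c * x.1, x.2) ∂((volume : Measure ℝ).prod μ)
      = c⁻¹ • ∫ x, f x ∂((volume : Measure ℝ).prod μ) := by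
  let e : ℝ × Z ≃ᵐ ℝ × Z :=
    (Homeomorph.mulLeft₀ c hc.ne').toMeasurableEquiv.prodCongr (MeasurableEquiv.refl Z)
  have he : (e : ℝ × Z → ℝ × Z) = Prod.map (c * ·) id := rfl
  have h := integral_map_equiv e f (μ := (volume : Measure ℝ).prod μ)
  rw [he, map_prod_mul_left hc.ne', integral_smul_measure, abs_of_pos (inv_pos.2 hc),
    ENNReal.toReal_ofReal (inv_pos.2 hc).le] at h
  rw [h]
  rfl

theorem integral_mul_eq_zero_of_odd {u v : ℝ → ℝ} (hu : ∀ x, u (-x) = u x)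
    (hv : ∀ x, v (-x) = -v x) : ∫ x, u x * v x = 0 := by
  have h := integral_neg_eq_self (fun x => u x * v x) (volume : Measure ℝ)
  simp only [hu, hv, mul_neg, integral_neg] at h
  linarith

end Product

/-! ### Variances of harmonizable integrands -/

section HermitianRows

variable {p : ℕ} {μ : Measure (EuclideanSpace ℂ (Fin p))} [SigmaFinite μ] {b : Fin p → ℝ → ℂ}

/-- Expand into `2p` real terms. Each mixed term pairs an even `Re b k` with an odd `Im b l` and
vanishes on integrating over frequency, so the mixed moments of `Re z` and `Im z` never enter. On
the rest, the square of the factor 2 cancels the moments `1/4`. -/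
theorem integral_two_re_sq (hμ : IsLevyMeasure₂ μ) (hI : HasComplexIdentitySecondMoment μ)
    (hb : ∀ k, MemLp (b k) 2 volume) (hbs : ∀ k x, b k (-x) = (starRingEnd ℂ) (b k x)) :
    ∫ x, (2 * (∑ k, b k x.1 * x.2 k).re) ^ 2 ∂((volume : Measure ℝ).prod μ)
      = ∫ x, ∑ k, ‖b k x‖ ^ 2 := by
  let a' : Fin p ⊕ Fin p → ℝ → ℝ :=
    Sum.elim (fun k s => 2 * (b k s).re) fun k s => -2 * (b k s).im
  let b' : Fin p ⊕ Fin p → EuclideanSpace ℂ (Fin p) → ℝ :=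
    Sum.elim (fun k z => (z k).re) fun k z => (z k).im
  have h1 : ∀ x : ℝ × EuclideanSpace ℂ (Fin p),
      2 * (∑ k, b k x.1 * x.2 k).re = ∑ k, a' k x.1 * b' k x.2 := by
    intro x
    simp only [a', b', Fintype.sum_sum_type, Sum.elim_inl, Sum.elim_inr, Complex.re_sum,
      Complex.mul_re, Finset.mul_sum, ← Finset.sum_add_distrib]
    refine Finset.sum_congr rfl fun k _ => ?_
    ring
  have ha' : ∀ k, MemLp (a' k) 2 volume := by
    rintro (k | k)
    · exact (hb k).re.const_mul 2
    · exact (hb k).im.const_mul (-2)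
  have hb' : ∀ k, MemLp (b' k) 2 μ := by
    rintro (k | k)
    · exact memLp_re_coord hμ k
    · exact memLp_im_coord hμ k
  have hre : ∀ k x, (b k (-x)).re = (b k x).re := fun k x => by simp [hbs]
  have him : ∀ k x, (b k (-x)).im = -(b k x).im := fun k x => by simp [hbs]
  have hx1 : ∀ k l, ∫ s, (2 * (b k s).re) * (-2 * (b l s).im) = 0 := fun k l =>
    integral_mul_eq_zero_of_odd (fun x => by rw [hre]) (fun x => by rw [him]; ring)
  have hx2 : ∀ k l, ∫ s, (-2 * (b k s).im) * (2 * (b l s).re) = 0 := fun k l => by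
    rw [← hx1 l k]; congr with s; ring
  have hr : ∀ k l : Fin p, ∫ z : EuclideanSpace ℂ (Fin p), (z k).re * (z l).re ∂μ
      = (1 / 4) * (1 : Matrix (Fin p) (Fin p) ℝ) k l := fun k l => by rw [← hI.1 k l]; ring
  have hi : ∀ k l : Fin p, ∫ z : EuclideanSpace ℂ (Fin p), (z k).im * (z l).im ∂μ
      = (1 / 4) * (1 : Matrix (Fin p) (Fin p) ℝ) k l := fun k l => by rw [← hI.2 k l]; ring
  simp_rw [h1]
  rw [integral_sum_mul_sq ha' hb']
  simp only [a', b', Fintype.sum_sum_type, Sum.elim_inl, Sum.elim_inr, hx1, hx2, hr, hi, zero_mul,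
    Finset.sum_const_zero, add_zero, zero_add, Matrix.one_apply, mul_ite, mul_zero,
    Finset.sum_ite_eq, Finset.mem_univ, if_true, mul_one]
  have hint : ∀ k, Integrable fun x => ‖b k x‖ ^ 2 := fun k => (hb k).norm.integrable_sq
  rw [integral_finsetSum _ fun k _ => hint k, ← Finset.sum_add_distrib]
  refine Finset.sum_congr rfl fun k _ => ?_
  rw [← integral_mul_const, ← integral_mul_const, ← integral_add]
  · congr with s
    rw [Complex.sq_norm, Complex.normSq_apply]; ring
  · exact ((ha' (Sum.inl k)).integrable_mul (ha' (Sum.inl k))).mul_const _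
  · exact ((ha' (Sum.inr k)).integrable_mul (ha' (Sum.inr k))).mul_const _

/-- Square integrability of a real harmonizable integrand forces that of its spectral row. -/
theorem memLp_of_memLp_two_re (hμ : IsLevyMeasure₂ μ) (hI : HasComplexIdentitySecondMoment μ)
    (hbm : ∀ k, Measurable (b k)) (hbs : ∀ k x, b k (-x) = (starRingEnd ℂ) (b k x))
    (h : MemLp (fun x : ℝ × EuclideanSpace ℂ (Fin p) => 2 * (∑ k, b k x.1 * x.2 k).re) 2
      ((volume : Measure ℝ).prod μ)) (k : Fin p) : MemLp (b k) 2 volume := by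
  let f : ℝ × EuclideanSpace ℂ (Fin p) → ℝ := fun x => 2 * (∑ k, b k x.1 * x.2 k).re
  -- Reflection of the frequency conjugates `b`, so the even and odd parts of the integrand isolate
  -- the sums of `Re b · Re z` and `Im b · Im z`.
  have hmp : MeasurePreserving (Prod.map Neg.neg id)
      ((volume : Measure ℝ).prod μ) ((volume : Measure ℝ).prod μ) :=
    (Measure.measurePreserving_neg volume).prod (MeasurePreserving.id μ)
  have hn : MemLp (f ∘ Prod.map Neg.neg id) 2 ((volume : Measure ℝ).prod μ) :=
    h.comp_measurePreserving hmp
  have hre : MemLp (fun x : ℝ × EuclideanSpace ℂ (Fin p) => ∑ k, (b k x.1).re * (x.2 k).re) 2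
      ((volume : Measure ℝ).prod μ) := by
    convert! (h.add hn).const_mul (1 / 4 : ℝ) using 1
    funext x
    simp only [f, Pi.add_apply, Function.comp_apply, Prod.map_fst, Prod.map_snd, id, hbs,
      Complex.re_sum, Complex.mul_re, Complex.conj_re, Complex.conj_im, Finset.mul_sum,
      ← Finset.sum_add_distrib]
    refine Finset.sum_congr rfl fun k _ => ?_
    ring
  have him : MemLp (fun x : ℝ × EuclideanSpace ℂ (Fin p) => ∑ k, (b k x.1).im * (x.2 k).im) 2
      ((volume : Measure ℝ).prod μ) := by
    convert! (hn.sub h).const_mul (1 / 4 : ℝ) using 1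
    funext x
    simp only [f, Pi.sub_apply, Function.comp_apply, Prod.map_fst, Prod.map_snd, id, hbs,
      Complex.re_sum, Complex.mul_re, Complex.conj_re, Complex.conj_im, Finset.mul_sum,
      ← Finset.sum_sub_distrib]
    refine Finset.sum_congr rfl fun k _ => ?_
    ring
  -- Integrating the square over `z` first leaves `¼ ∑ a_k²`, because the `r_k` are orthogonal in
  -- `L²(μ)`; each `a_k²` is then dominated.
  have key : ∀ (a : Fin p → ℝ → ℝ) (r : Fin p → EuclideanSpace ℂ (Fin p) → ℝ),
      (∀ k, Measurable (a k)) → (∀ k, MemLp (r k) 2 μ) →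
      (∀ k l, ∫ z, r k z * r l z ∂μ = (1 / 4) * (1 : Matrix (Fin p) (Fin p) ℝ) k l) →
      MemLp (fun x : ℝ × EuclideanSpace ℂ (Fin p) => ∑ k, a k x.1 * r k x.2) 2
        ((volume : Measure ℝ).prod μ) → MemLp (a k) 2 volume := by
    intro a r ham hr hrI hmem
    have h1 := hmem.integrable_sq.integral_prod_left
    have h2 : ∀ s, ∫ z, (∑ k, a k s * r k z) ^ 2 ∂μ = 1 / 4 * ∑ k, a k s ^ 2 := by
      intro s
      have e : ∀ z, (∑ k, a k s * r k z) ^ 2 = ∑ k, ∑ l, (a k s * a l s) * (r k z * r l z) := by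
        intro z
        rw [sq, Finset.sum_mul_sum]
        exact Finset.sum_congr rfl fun k _ => Finset.sum_congr rfl fun l _ => by ring
      have hint : ∀ k l, Integrable (fun z => (a k s * a l s) * (r k z * r l z)) μ := fun k l =>
        ((hr k).integrable_mul (hr l)).const_mul _
      simp_rw [e]
      rw [integral_finsetSum _ fun k _ => integrable_finsetSum _ fun l _ => hint k l,
        Finset.mul_sum]
      refine Finset.sum_congr rfl fun k _ => ?_
      rw [integral_finsetSum _ fun l _ => hint k l]
      simp only [integral_const_mul, hrI, Matrix.one_apply, mul_ite, mul_zero, Finset.sum_ite_eq,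
        Finset.mem_univ, if_true]
      ring
    simp only [h2] at h1
    rw [memLp_two_iff_integrable_sq (ham k).aestronglyMeasurable]
    refine (h1.const_mul 4).mono' ((ham k).pow_const 2).aestronglyMeasurable (ae_of_all _ fun s => ?_)
    rw [Real.norm_eq_abs, abs_of_nonneg (sq_nonneg _)]
    have := Finset.single_le_sum (f := fun k => a k s ^ 2) (fun k _ => sq_nonneg (a k s))
      (Finset.mem_univ k)
    linarith
  have hR := key (fun k s => (b k s).re) (fun k z => (z k).re)
    (fun k => Complex.measurable_re.comp (hbm k)) (memLp_re_coord hμ)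
    (fun k l => by rw [← hI.1 k l]; ring) hre
  have hIm := key (fun k s => (b k s).im) (fun k z => (z k).im)
    (fun k => Complex.measurable_im.comp (hbm k)) (memLp_im_coord hμ)
    (fun k l => by rw [← hI.2 k l]; ring) him
  exact memLp_re_im_iff.1 ⟨hR, hIm⟩

end HermitianRows

/-! ### The moving average process at large scales -/

section MovingAverage

variable {p : ℕ} {H : Matrix (Fin p) (Fin p) ℝ} {A : Matrix (Fin p) (Fin p) ℂ}
  {g : ℝ → ℝ → Matrix (Fin p) (Fin p) ℝ} {J : Type*} [Fintype J]

/-- The row vector `∑ j, θ_jᵀ g_{t_j}(s)`. -/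
def timeRow (g : ℝ → ℝ → Matrix (Fin p) (Fin p) ℝ) (t : J → ℝ)
    (θ : J → EuclideanSpace ℝ (Fin p)) (k : Fin p) (s : ℝ) : ℝ :=
  ∑ j, ∑ i, θ j i * g (t j) s i k

theorem sum_inner_toEuclideanLin (t : J → ℝ) (θ : J → EuclideanSpace ℝ (Fin p)) (s : ℝ)
    (z : EuclideanSpace ℝ (Fin p)) :
    ∑ j, inner ℝ (θ j) (Matrix.toEuclideanLin (g (t j) s) z) = ∑ k, timeRow g t θ k s * z k := by
  simp only [timeRow, Finset.sum_mul]
  rw [Finset.sum_comm]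
  refine Finset.sum_congr rfl fun j _ => ?_
  rw [Finset.sum_comm]
  simp only [PiLp.inner_apply, Matrix.toLpLin_apply, Matrix.mulVec, dotProduct]
  refine Finset.sum_congr rfl fun i _ => ?_
  simp only [RCLike.inner_apply, conj_trivial, Finset.sum_mul]
  exact Finset.sum_congr rfl fun l _ => by ring

theorem isL2Fourier_timeRow (hg : IsTimeKernel H A g) (t : J → ℝ)
    (θ : J → EuclideanSpace ℝ (Fin p)) (k : Fin p) :
    IsL2Fourier (fun s => (timeRow g t θ k s : ℂ)) (fun x => specRow H A t θ x k) := by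
  have h := IsL2Fourier.sum (Finset.univ : Finset J) fun j _ =>
    IsL2Fourier.sum (Finset.univ : Finset (Fin p)) fun i _ =>
      (hg (t j) i k).const_mul (θ j i : ℂ)
  simpa [specRow_apply, timeRow] using h

theorem IsL2Fourier.memLp_right {f F : ℝ → ℂ} (h : IsL2Fourier f F) : MemLp F 2 volume := by
  obtain ⟨-, hF, -⟩ := h
  have h1 := memLp_comp_mul hF (c := -(2 * Real.pi)⁻¹) (by simp [Real.pi_ne_zero])
  convert! h1 using 2
  field_simp

theorem memLp_timeRow (hg : IsTimeKernel H A g) (t : J → ℝ)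
    (θ : J → EuclideanSpace ℝ (Fin p)) (k : Fin p) : MemLp (timeRow g t θ k) 2 volume := by
  obtain ⟨h, -, -⟩ := isL2Fourier_timeRow hg t θ k
  simpa using h.re

/-- Self-similarity of the time domain rows, read off the Fourier domain. -/
theorem timeRow_mul_ae_eq (hg : IsTimeKernel H A g) {c : ℝ} (hc : 0 < c) (t : J → ℝ)
    (θ : J → EuclideanSpace ℝ (Fin p)) (k : Fin p) :
    ∀ᵐ s, timeRow g (fun j => c * t j) θ k s = (Real.sqrt c)⁻¹ * timeRow g t
      (fun j => Matrix.toEuclideanLin (matPow c H).transpose (θ j)) k (s / c) := by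
  have h1 := isL2Fourier_timeRow hg (fun j => c * t j) θ k
  have h2 := ((isL2Fourier_timeRow hg t
    (fun j => Matrix.toEuclideanLin (matPow c H).transpose (θ j)) k).comp_div hc).const_mul
      (((Real.sqrt c)⁻¹ : ℝ) : ℂ)
  have h3 : (fun x => specRow H A (fun j => c * t j) θ x k) = fun x =>
      (((Real.sqrt c)⁻¹ : ℝ) : ℂ) * (c * specRow H A t
        (fun j => Matrix.toEuclideanLin (matPow c H).transpose (θ j)) (c * x) k) := by
    funext x
    rw [specRow_mul H A hc, Pi.smul_apply, smul_eq_mul, ← mul_assoc, ← Complex.ofReal_mul]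
    congr 2
    have := Real.mul_self_sqrt hc.le
    have h0 : Real.sqrt c ≠ 0 := (Real.sqrt_pos.2 hc).ne'
    field_simp
    linarith
  rw [h3] at h1
  filter_upwards [h1.ae_eq h2] with s hs
  exact_mod_cast hs

variable {μ : Measure (EuclideanSpace ℝ (Fin p))} [SigmaFinite μ]

/-- Identity second moments remove the off-diagonal terms, and Parseval transfers the diagonal ones
to frequency. -/
theorem integral_timeRow_sq (hμ : IsLevyMeasure₂ μ) (hI : HasIdentitySecondMoment μ)
    (hg : IsTimeKernel H A g) (t : J → ℝ) (θ : J → EuclideanSpace ℝ (Fin p)) :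
    ∫ x, (∑ k, timeRow g t θ k x.1 * x.2 k) ^ 2 ∂((volume : Measure ℝ).prod μ)
      = (2 * Real.pi)⁻¹ * specEnergy H A t θ := by
  refine (integral_sum_mul_sq (μ := μ) (b := fun k (z : EuclideanSpace ℝ (Fin p)) => z k)
    (memLp_timeRow hg t θ) fun k => (EuclideanSpace.proj (𝕜 := ℝ) k :
      EuclideanSpace ℝ (Fin p) →L[ℝ] ℝ).comp_memLp' hμ.memLp_id).trans ?_
  have hI' : ∀ k l : Fin p, ∫ z : EuclideanSpace ℝ (Fin p), z k * z l ∂μ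
    = (1 : Matrix (Fin p) (Fin p) ℝ) k l := hI
  simp only [hI', Matrix.one_apply, mul_ite, mul_zero, Finset.sum_ite_eq, Finset.mem_univ, if_true,
    mul_one, specEnergy]
  rw [integral_finsetSum _ fun k _ =>
    ((isL2Fourier_timeRow hg t θ k).memLp_right.norm.integrable_sq), Finset.mul_sum]
  refine Finset.sum_congr rfl fun k _ => ?_
  rw [← (isL2Fourier_timeRow hg t θ k).integral_norm_sq]
  congr with s
  rw [Complex.norm_real, Real.norm_eq_abs, sq_abs, sq]

end MovingAverage

theorem toEuclideanLin_transpose_matPow_cancel {p : ℕ} (c : ℝ) (H : Matrix (Fin p) (Fin p) ℝ)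
    (θ : EuclideanSpace ℝ (Fin p)) :
    Matrix.toEuclideanLin (matPow c H).transpose
      (Matrix.toEuclideanLin (matPow c (-H)).transpose θ) = θ := by
  have h : (matPow c H).transpose * (matPow c (-H)).transpose = 1 := by
    rw [← Matrix.transpose_mul, matPow_mul_matPow_neg, Matrix.transpose_one]
  simp [Matrix.toLpLin_apply, Matrix.mulVec_mulVec, h]

/-- The exponent of `c^{-H} X(ct)` equals `c ∫ compExp(c^{-1/2} G) dν` with `G` independent of `c`:
this is `tendsto_integral_compExp_scaled` with `δ = c^{-1/2}`. -/
theorem exists_limit_of_isMaofLm {p : ℕ} {H : Matrix (Fin p) (Fin p) ℝ} {Ω : Type u}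
    [MeasurableSpace Ω] {P : Measure Ω} [IsProbabilityMeasure P]
    {X : ℝ → Ω → EuclideanSpace ℝ (Fin p)} {A : Matrix (Fin p) (Fin p) ℂ}
    {μ : Measure (EuclideanSpace ℝ (Fin p))} (hX : IsMaofLm.{u, v} P X H A μ)
    (hI : HasIdentitySecondMoment μ) :
    ∃ (Ω' : Type) (_ : MeasurableSpace Ω') (P' : Measure Ω') (_ : IsProbabilityMeasure P')
      (B : ℝ → Ω' → EuclideanSpace ℝ (Fin p)), IsOfBm P' B H ∧
      FddTendsto P (fun c t ω => Matrix.toEuclideanLin (matPow c (-H)) (X (c * t) ω))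
        atTop P' B := by
  obtain ⟨Ω', _, P', N, g, Y, _, hN, hg, hY, hXY⟩ := hX.representation
  have hμ := hX.levy
  have := hμ.sigmaFinite
  set ν := (volume : Measure ℝ).prod μ with hν
  let φ : ℝ → ℝ × EuclideanSpace ℝ (Fin p) → EuclideanSpace ℝ (Fin p) := fun t x =>
    Matrix.toEuclideanLin (g t x.1) x.2
  have henergy : ∀ (J : Type) [Fintype J] (t : J → ℝ) (θ : J → EuclideanSpace ℝ (Fin p)),
      energy ν φ t θ = (2 * Real.pi)⁻¹ * specEnergy H A t θ := by
    intro J _ t θ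
    rw [← integral_timeRow_sq hμ hI hg t θ]
    simp only [energy, φ, sum_inner_toEuclideanLin, hν]
  obtain ⟨Ω'', _, Q, _, B, hB, hBm, hBc⟩ := exists_isOfBm_of_stochIntegral hN (φ := φ) hY hXY
    hX.proper hX.hurst
    (fun c hc J _ t θ => by rw [henergy, henergy, specEnergy_mul H A hc])
    (fun h J _ t θ => by
      -- The increments from time zero are the case of shift zero, so both sides equal `specEnergy H
      -- A t θ`.
      have h0 := specEnergy_increment H A t 0 θ
      simp only [add_zero] at h0
      rw [henergy, henergy, specEnergy_increment, h0])
  refine ⟨Ω'', _, Q, ‹_›, B, hB, ?_⟩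
  have hXm := hXY.aemeasurable_left
  refine fddTendsto_of_tendsto_fddCharFun
    (fun c t => aemeasurable_toEuclideanLin _ (hXm (c * t))) hBm fun I θ => ?_
  set t : I → ℝ := fun i => i
  let G : ℝ × EuclideanSpace ℝ (Fin p) → ℝ := fun x => ∑ k, timeRow g t θ k x.1 * x.2 k
  have hG : MemLp G 2 ν := by
    have := memLp_sum_inner (fun j : I => (hY (t j)).1) θ
    simpa only [sum_inner_toEuclideanLin] using this
  have hlim := tendsto_integral_compExp_scaled (ν := ν) (l := atTop)
    (δ := fun c : ℝ => (Real.sqrt c)⁻¹) (G := fun _ => G) (V := fun x => |G x|)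
    (q := energy ν φ t θ)
    (Real.tendsto_sqrt_atTop.inv_tendsto_atTop)
    (by filter_upwards [eventually_gt_atTop 0] with c hc
        exact inv_ne_zero (Real.sqrt_pos.2 hc).ne')
    hG.abs (fun _ => hG.1) (fun _ _ => le_rfl)
    (Eventually.of_forall fun _ => by simp only [energy, φ, sum_inner_toEuclideanLin, G])
  rw [hBc]
  refine ((Complex.continuous_exp.tendsto _).comp hlim).congr' ?_
  filter_upwards [eventually_gt_atTop 0] with c hc
  have e1 : fddCharFun P (fun t ω => Matrix.toEuclideanLin (matPow c (-H)) (X (c * t) ω)) t θ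
      = fddCharFun P X (fun j => c * t j)
          (fun j => Matrix.toEuclideanLin (matPow c (-H)).transpose (θ j)) :=
    fddCharFun_toEuclideanLin P (fun t => X (c * t)) (matPow c (-H)) t θ
  rw [Function.comp_apply, e1, hXY.fddCharFun_eq, fddCharFun_stochIntegral hN hY]
  congr 1
  simp only [sum_inner_toEuclideanLin]
  have e2 : ∀ᵐ x ∂ν, ∑ k, timeRow g (fun j => c * t j)
      (fun j => Matrix.toEuclideanLin (matPow c (-H)).transpose (θ j)) k x.1 * x.2 k
      = (Real.sqrt c)⁻¹ * G (c⁻¹ * x.1, x.2) := by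
    have h1 : ∀ᵐ s : ℝ, ∀ k, timeRow g (fun j => c * t j)
        (fun j => Matrix.toEuclideanLin (matPow c (-H)).transpose (θ j)) k s
        = (Real.sqrt c)⁻¹ * timeRow g t θ k (s / c) := by
      rw [ae_all_iff]
      intro k
      have := timeRow_mul_ae_eq hg hc t
        (fun j => Matrix.toEuclideanLin (matPow c (-H)).transpose (θ j)) k
      simpa only [toEuclideanLin_transpose_matPow_cancel] using this
    filter_upwards [Measure.quasiMeasurePreserving_fst.ae h1] with x hx
    simp only [hx, G, Finset.mul_sum, mul_assoc, div_eq_inv_mul]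
  have e3 : ∫ x, compExp (∑ k, timeRow g (fun j => c * t j)
      (fun j => Matrix.toEuclideanLin (matPow c (-H)).transpose (θ j)) k x.1 * x.2 k) ∂ν
      = ∫ x, compExp ((Real.sqrt c)⁻¹ * G (c⁻¹ * x.1, x.2)) ∂ν :=
    integral_congr_ae (by filter_upwards [e2] with x hx; rw [hx])
  -- The Jacobian of the time dilation is `c`, which is exactly `δ⁻²`.
  rw [e3, hν, integral_prod_comp_mul_left (inv_pos.2 hc)
    (fun x => compExp ((Real.sqrt c)⁻¹ * G x)), inv_inv, Complex.real_smul]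
  congr 1
  rw [Complex.ofReal_inv, inv_pow, inv_inv, ← Complex.ofReal_pow, Real.sq_sqrt hc.le]

/-! ### The harmonizable process at small scales -/

section Harmonizable

variable {p : ℕ} {H : Matrix (Fin p) (Fin p) ℝ} {A : Matrix (Fin p) (Fin p) ℂ}
  {J : Type*} [Fintype J]

/-- The integrand of the real harmonizable representation. -/
def harmIntegrand (H : Matrix (Fin p) (Fin p) ℝ) (A : Matrix (Fin p) (Fin p) ℂ) (t : ℝ)
    (x : ℝ × EuclideanSpace ℂ (Fin p)) : EuclideanSpace ℝ (Fin p) :=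
  WithLp.toLp 2 (fun i => 2 * (Matrix.toEuclideanLin (harmKernel H A t x.1) x.2 i).re)

theorem sum_inner_harmIntegrand (t : J → ℝ) (θ : J → EuclideanSpace ℝ (Fin p))
    (x : ℝ × EuclideanSpace ℂ (Fin p)) :
    ∑ j, inner ℝ (θ j) (harmIntegrand H A (t j) x)
      = 2 * (∑ k, specRow H A t θ x.1 k * x.2 k).re := by
  simp only [specRow_apply, Finset.sum_mul]
  rw [Finset.sum_comm]
  rw [Complex.re_sum, Finset.mul_sum]
  refine Finset.sum_congr rfl fun j _ => ?_
  rw [Finset.sum_comm, Complex.re_sum, Finset.mul_sum]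
  simp only [harmIntegrand, PiLp.inner_apply, Matrix.toLpLin_apply, Matrix.mulVec, dotProduct]
  refine Finset.sum_congr rfl fun i _ => ?_
  simp only [mul_assoc, ← Finset.mul_sum, Complex.re_ofReal_mul]
  simp
  ring

variable {μ : Measure (EuclideanSpace ℂ (Fin p))} [SigmaFinite μ]

/-- Square integrability of the spectral rows is read off from that of the integrands of the
stochastic integrals. -/
theorem memLp_specRow (hμ : IsLevyMeasure₂ μ) (hI : HasComplexIdentitySecondMoment μ)
    (h : ∀ t, MemLp (harmIntegrand H A t) 2 ((volume : Measure ℝ).prod μ)) (t : J → ℝ)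
    (θ : J → EuclideanSpace ℝ (Fin p)) (k : Fin p) :
    MemLp (fun x => specRow H A t θ x k) 2 volume := by
  refine memLp_of_memLp_two_re (b := fun k x => specRow H A t θ x k) hμ hI
    (measurable_specRow H A t θ) (fun k x => specRow_neg H A t θ x k) ?_ k
  have := memLp_sum_inner (fun j : J => h (t j)) θ
  simpa only [sum_inner_harmIntegrand] using this

end Harmonizable

/-- In frequency the kernel gains a factor `√ε` and the substitution `y = εx` has Jacobian `ε⁻¹`, so
`δ = √ε` is small precisely at small scales. -/
theorem exists_limit_of_isRhofLm {p : ℕ} {H : Matrix (Fin p) (Fin p) ℝ} {Ω : Type u}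
    [MeasurableSpace Ω] {P : Measure Ω} [IsProbabilityMeasure P]
    {X : ℝ → Ω → EuclideanSpace ℝ (Fin p)} {A : Matrix (Fin p) (Fin p) ℂ}
    {μ : Measure (EuclideanSpace ℂ (Fin p))} (hX : IsRhofLm.{u, v} P X H A μ)
    (hI : HasComplexIdentitySecondMoment μ) :
    ∃ (Ω' : Type) (_ : MeasurableSpace Ω') (P' : Measure Ω') (_ : IsProbabilityMeasure P')
      (B : ℝ → Ω' → EuclideanSpace ℝ (Fin p)), IsOfBm P' B H ∧
      ∀ s : ℝ, FddTendsto P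
        (fun ε t ω => Matrix.toEuclideanLin (matPow ε (-H)) (X (s + ε * t) ω - X s ω))
        (𝓝[>] 0) P' B := by
  obtain ⟨Ω', _, P', N, Y, _, hN, hY, hXY⟩ := hX.representation
  have hμ := hX.levy
  have := hμ.sigmaFinite
  set ν := (volume : Measure ℝ).prod μ with hν
  have hYL : ∀ t, MemLp (harmIntegrand H A t) 2 ν := fun t => (hY t).1
  have henergy : ∀ (J : Type) [Fintype J] (t : J → ℝ) (θ : J → EuclideanSpace ℝ (Fin p)),
      energy ν (harmIntegrand H A) t θ = specEnergy H A t θ := by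
    intro J _ t θ
    simp only [energy, sum_inner_harmIntegrand]
    exact integral_two_re_sq (b := fun k x => specRow H A t θ x k) hμ hI
      (memLp_specRow hμ hI hYL t θ) fun k x => specRow_neg H A t θ x k
  obtain ⟨Ω'', _, Q, _, B, hB, hBm, hBc⟩ := exists_isOfBm_of_stochIntegral hN
    (φ := harmIntegrand H A) hY hXY hX.proper hX.hurst
    (fun c hc J _ t θ => by rw [henergy, henergy, specEnergy_mul H A hc])
    (fun h J _ t θ => by
      have h0 := specEnergy_increment H A t 0 θ
      simp only [add_zero] at h0
      rw [henergy, henergy, specEnergy_increment, h0])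
  refine ⟨Ω'', _, Q, ‹_›, B, hB, fun s => ?_⟩
  have hXm := hXY.aemeasurable_left
  refine fddTendsto_of_tendsto_fddCharFun
    (fun c t => aemeasurable_toEuclideanLin _ ((hXm _).sub (hXm s))) hBm fun I θ => ?_
  set t : I → ℝ := fun i => i
  -- The increment from `s` brings the phase `e^{isx}`, which after `y = εx` oscillates like
  -- `e^{isy/ε}`. It keeps Hermitian symmetry and modulus, so the variance is constant in `ε` and
  -- `V` is a common majorant.
  let r : ℝ → Fin p → ℝ → ℂ := fun ε k y =>
    Complex.exp (Complex.I * s * ↑(ε⁻¹ * y)) * specRow H A t θ y k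
  let G : ℝ → ℝ × EuclideanSpace ℂ (Fin p) → ℝ := fun ε x => 2 * (∑ k, r ε k x.1 * x.2 k).re
  let V : ℝ × EuclideanSpace ℂ (Fin p) → ℝ := fun x =>
    ∑ k, (2 * ‖specRow H A t θ x.1 k‖) * ‖x.2 k‖
  have hrow := memLp_specRow hμ hI hYL t θ
  have hnorm : ∀ ε k y, ‖r ε k y‖ = ‖specRow H A t θ y k‖ := fun ε k y => by
    simp only [r, norm_mul, norm_exp_I_mul_mul, one_mul]
  have hrm : ∀ ε k, Measurable (r ε k) := fun ε k =>
    Measurable.mul (by fun_prop) (measurable_specRow H A t θ k)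
  have hr : ∀ ε k, MemLp (r ε k) 2 volume := fun ε k =>
    (hrow k).congr_norm (hrm ε k).aestronglyMeasurable (ae_of_all _ fun y => (hnorm ε k y).symm)
  have hrs : ∀ ε k y, r ε k (-y) = (starRingEnd ℂ) (r ε k y) := by
    intro ε k y
    simp only [r, specRow_neg, map_mul, ← Complex.exp_conj]
    simp
  have hV : MemLp V 2 ν := memLp_finsetSum _ fun k _ =>
    memLp_mul_prod ((hrow k).norm.const_mul 2)
      ((EuclideanSpace.proj (𝕜 := ℂ) k : EuclideanSpace ℂ (Fin p) →L[ℂ] ℂ).comp_memLp'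
        hμ.memLp_id).norm
  have hGV : ∀ ε x, |G ε x| ≤ V x := by
    intro ε x
    simp only [G, V, abs_mul, abs_two, mul_assoc, ← Finset.mul_sum]
    gcongr
    refine (Complex.abs_re_le_norm _).trans ((norm_sum_le _ _).trans ?_)
    refine Finset.sum_le_sum fun k _ => ?_
    rw [norm_mul, hnorm]
  have hlim := tendsto_integral_compExp_scaled (ν := ν) (l := 𝓝[>] (0 : ℝ))
    (δ := Real.sqrt) (G := G) (V := V) (q := energy ν (harmIntegrand H A) t θ)
    (by
      have := (Real.continuous_sqrt.tendsto 0).mono_left (nhdsWithin_le_nhds (s := Set.Ioi 0))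
      rwa [Real.sqrt_zero] at this)
    (by filter_upwards [self_mem_nhdsWithin] with c hc
        exact (Real.sqrt_pos.2 hc).ne')
    hV
    (fun ε => by
      have : Measurable (G ε) := by
        refine Measurable.const_mul (Complex.measurable_re.comp ?_) 2
        exact Finset.measurable_sum _ fun k _ =>
          ((hrm ε k).comp measurable_fst).mul (by fun_prop)
      exact this.aestronglyMeasurable)
    hGV
    (Eventually.of_forall fun ε => by
      rw [henergy, specEnergy]
      simp only [G, hν, integral_two_re_sq hμ hI (hr ε) (hrs ε), hnorm])
  rw [hBc]
  refine ((Complex.continuous_exp.tendsto _).comp hlim).congr' ?_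
  filter_upwards [self_mem_nhdsWithin] with ε (hε : 0 < ε)
  let θ' : I → EuclideanSpace ℝ (Fin p) := fun j =>
    Matrix.toEuclideanLin (matPow ε (-H)).transpose (θ j)
  have e1 : fddCharFun P
      (fun t ω => Matrix.toEuclideanLin (matPow ε (-H)) (X (s + ε * t) ω - X s ω)) t θ
      = fddCharFun P X (Sum.elim (fun j => s + ε * t j) fun _ => s)
          (Sum.elim θ' fun j => -θ' j) := by
    rw [← fddCharFun_increment P X (fun t => s + ε * t) s t θ']
    exact fddCharFun_toEuclideanLin P (fun t ω => X (s + ε * t) ω - X s ω) (matPow ε (-H)) t θ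
  have e2 := fddCharFun_stochIntegral hN (φ := harmIntegrand H A) hY
    (Sum.elim (fun j => s + ε * t j) fun _ => s) (Sum.elim θ' fun j => -θ' j)
  rw [Function.comp_apply, e1, hXY.fddCharFun_eq, e2]
  congr 1
  simp only [sum_inner_harmIntegrand]
  have e3 : ∀ x : ℝ × EuclideanSpace ℂ (Fin p),
      2 * (∑ k, specRow H A (Sum.elim (fun j => s + ε * t j) fun _ => s)
        (Sum.elim θ' fun j => -θ' j) x.1 k * x.2 k).re
      = Real.sqrt ε * G ε (ε * x.1, x.2) := by
    intro x
    have h1 : ∀ k, specRow H A (Sum.elim (fun j => s + ε * t j) fun _ => s)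
        (Sum.elim θ' fun j => -θ' j) x.1 k = (Real.sqrt ε : ℂ) * r ε k (ε * x.1) := by
      intro k
      simp only [add_comm s]
      rw [specRow_increment H A (fun j => ε * t j) s θ', specRow_mul H A hε]
      simp only [θ', toEuclideanLin_transpose_matPow_cancel, r, Pi.smul_apply, smul_eq_mul]
      rw [inv_mul_cancel_left₀ hε.ne']
      ring
    simp only [h1, G, mul_assoc, ← Finset.mul_sum, Complex.re_ofReal_mul]
    ring
  simp_rw [e3]
  rw [hν, integral_prod_comp_mul_left hε (fun x => compExp (Real.sqrt ε * G ε x)),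
    Complex.real_smul, ← Complex.ofReal_pow, Real.sq_sqrt hε.le, Complex.ofReal_inv]

end OfLm

end

theorem propositionp {p : ℕ} (H : Matrix (Fin p) (Fin p) ℝ)
    (hH : OfLm.ReEigIn H (Set.Ioo 0 1)) :
    (∀ (Ω : Type u) [MeasurableSpace Ω] (P : Measure Ω) [IsProbabilityMeasure P]
      (X : ℝ → Ω → EuclideanSpace ℝ (Fin p)) (A : Matrix (Fin p) (Fin p) ℂ)
      (μ : Measure (EuclideanSpace ℝ (Fin p))),
      OfLm.IsMaofLm.{u, v} P X H A μ → OfLm.HasIdentitySecondMoment μ →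
      ∃ (Ω' : Type) (_ : MeasurableSpace Ω') (P' : Measure Ω') (_ : IsProbabilityMeasure P')
        (B : ℝ → Ω' → EuclideanSpace ℝ (Fin p)),
        OfLm.IsOfBm P' B H ∧
        OfLm.FddTendsto P
          (fun c t ω => Matrix.toEuclideanLin (OfLm.matPow c (-H)) (X (c * t) ω))
          atTop P' B) ∧
    (∀ (Ω : Type u) [MeasurableSpace Ω] (P : Measure Ω) [IsProbabilityMeasure P]
      (X : ℝ → Ω → EuclideanSpace ℝ (Fin p)) (A : Matrix (Fin p) (Fin p) ℂ)
      (μ : Measure (EuclideanSpace ℂ (Fin p))),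
      OfLm.IsRhofLm.{u, v} P X H A μ → OfLm.HasComplexIdentitySecondMoment μ →
      ∃ (Ω' : Type) (_ : MeasurableSpace Ω') (P' : Measure Ω') (_ : IsProbabilityMeasure P')
        (B : ℝ → Ω' → EuclideanSpace ℝ (Fin p)),
        OfLm.IsOfBm P' B H ∧
        ∀ s : ℝ, OfLm.FddTendsto P
          (fun ε t ω => Matrix.toEuclideanLin (OfLm.matPow ε (-H)) (X (s + ε * t) ω - X s ω))
          (𝓝[>] 0) P' B) := by
  exact ⟨fun _ _ _ _ _ _ _ hX hI => OfLm.exists_limit_of_isMaofLm hX hI,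
    fun _ _ _ _ _ _ _ hX hI => OfLm.exists_limit_of_isRhofLm hX hI⟩
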